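/- Let $K$ be an arbitrary field and let $M_{mn}$ be the space of $m\times n$ matrices over $K$, with matrix units $e_{ij}$. In $M_{mn}\otimes M_{np}\otimes M_{pm}$ put $\langle m,n,p\rangle=\sum_{i,j,k}e_{ij}\otimes e_{jk}\otimes e_{ki}$. An algorithm of length $r$ computing a tensor $t$ of a tensor product $U_1\otimes\dots\otimes U_s$ of vector spaces is a set of $r$ decomposable tensors with sum $t$. A decomposable automorphism of $U_1\otimes\dots\otimes U_s$ is a linear automorphism $\varphi$ for which there are a permutation $\tau$ of $\{1,\dots,s\}$ and isomorphisms $\varphi_i:U_i\to U_{\tau(i)}$ such that $\varphi$ takes every $u_1\otimes\dots\otimes u_s$ to $v_1\otimes\dots\otimes v_s$, where $v_{\tau(i)}=\varphi_i(u_i)$ for all $i$. For a set $\mathcal A$ of tensors, $\mathrm{Aut}(\mathcal A)$ is the group of all decomposable automorphisms $\varphi$ with $\varphi(\mathcal A)=\mathcal A$. Let $\mathcal H=\{t_1,\dots,t_{15}\}\subset M_{32}\otimes M_{23}\otimes M_{33}$ be the Hopcroft algorithm (in tensor form), where $t_{1}=(e_{11}-e_{12})\otimes e_{11}\otimes (e_{11}-e_{12}-e_{31})$;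 $t_{2}=e_{12}\otimes (e_{11}+e_{21})\otimes (e_{11}-e_{13}-e_{21})$; $t_{3}=e_{21}\otimes e_{12}\otimes (-e_{21}+e_{22}-e_{32})$; $t_{4}=e_{22}\otimes e_{22}\otimes (-e_{12}+e_{22}-e_{23})$; $t_{5}=e_{31}\otimes (e_{13}+e_{23})\otimes (-e_{23}-e_{31}+e_{33})$; $t_{6}=(-e_{31}+e_{32})\otimes e_{23}\otimes (-e_{13}-e_{32}+e_{33})$; $t_{7}=(e_{11}+e_{21})\otimes (e_{11}+e_{12}+e_{21}+e_{22})\otimes e_{21}$; $t_{8}=(e_{11}-e_{12}+e_{21})\otimes (e_{11}+e_{21}+e_{22})\otimes (e_{12}-e_{21})$; $t_{9}=(e_{11}-e_{12}+e_{21}-e_{22})\otimes (e_{21}+e_{22})\otimes (-e_{12})$; $t_{10}=(e_{22}+e_{32})\otimes (e_{12}+e_{13}+e_{22}+e_{23})\otimes e_{23}$; $t_{11}=(e_{22}-e_{31}+e_{32})\otimes (e_{12}+e_{13}+e_{23})\otimes (-e_{23}+e_{32})$; $t_{12}=(-e_{21}+e_{22}-e_{31}+e_{32})\otimes (e_{12}+e_{13})\otimes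 (-e_{32})$; $t_{13}=(e_{12}+e_{31})\otimes (e_{11}-e_{23})\otimes (e_{13}-e_{31})$; $t_{14}=(e_{12}+e_{32})\otimes (e_{21}+e_{23})\otimes e_{13}$; $t_{15}=(e_{11}+e_{31})\otimes (e_{11}+e_{13})\otimes e_{31}$. Let $\mathcal L=\{t_1,\dots,t_{23}\}\subset M_{33}\otimes M_{33}\otimes M_{33}$ be the Laderman algorithm (in tensor form), where $t_{1}=(e_{11}+e_{12}+e_{13}-e_{21}-e_{22}-e_{32}-e_{33})\otimes e_{22}\otimes e_{21}$; $t_{2}=(e_{11}-e_{21})\otimes (-e_{12}+e_{22})\otimes (e_{12}+e_{22})$; $t_{3}=e_{22}\otimes (-e_{11}+e_{12}+e_{21}-e_{22}-e_{23}-e_{31}+e_{33})\otimes e_{12}$; $t_{4}=(-e_{11}+e_{21}+e_{22})\otimes (e_{11}-e_{12}+e_{22})\otimes (e_{12}+e_{21}+e_{22})$; $t_{5}=(e_{21}+e_{22})\otimes (-e_{11}+e_{12})\otimes (e_{21}+e_{22})$; $t_{6}=e_{11}\otimes e_{11}\otimes (e_{11}+e_{12}+e_{13}+e_{21}+e_{22}+e_{31}+e_{33})$;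 $t_{7}=(-e_{11}+e_{31}+e_{32})\otimes (e_{11}-e_{13}+e_{23})\otimes (e_{13}+e_{31}+e_{33})$; $t_{8}=(-e_{11}+e_{31})\otimes (e_{13}-e_{23})\otimes (e_{13}+e_{33})$; $t_{9}=(e_{31}+e_{32})\otimes (-e_{11}+e_{13})\otimes (e_{31}+e_{33})$; $t_{10}=(e_{11}+e_{12}+e_{13}-e_{22}-e_{23}-e_{31}-e_{32})\otimes e_{23}\otimes e_{31}$; $t_{11}=e_{32}\otimes (-e_{11}+e_{13}+e_{21}-e_{22}-e_{23}-e_{31}+e_{32})\otimes e_{13}$; $t_{12}=(-e_{13}+e_{32}+e_{33})\otimes (e_{22}+e_{31}-e_{32})\otimes (e_{13}+e_{21}+e_{23})$; $t_{13}=(e_{13}-e_{33})\otimes (e_{22}-e_{32})\otimes (e_{13}+e_{23})$; $t_{14}=e_{13}\otimes e_{31}\otimes (e_{11}+e_{12}+e_{13}+e_{21}+e_{23}+e_{31}+e_{32})$; $t_{15}=(e_{32}+e_{33})\otimes (-e_{31}+e_{32})\otimes (e_{21}+e_{23})$; $t_{16}=(-e_{13}+e_{22}+e_{23})\otimes (e_{23}+e_{31}-e_{33})\otimes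 (e_{12}+e_{31}+e_{32})$; $t_{17}=(e_{13}-e_{23})\otimes (e_{23}-e_{33})\otimes (e_{12}+e_{32})$; $t_{18}=(e_{22}+e_{23})\otimes (-e_{31}+e_{33})\otimes (e_{31}+e_{32})$; $t_{19}=e_{12}\otimes e_{21}\otimes e_{11}$; $t_{20}=e_{23}\otimes e_{32}\otimes e_{22}$; $t_{21}=e_{21}\otimes e_{13}\otimes e_{32}$; $t_{22}=e_{31}\otimes e_{12}\otimes e_{23}$; $t_{23}=e_{33}\otimes e_{33}\otimes e_{33}$. Let $\pi_{12},\pi_{13},\pi_{23}$ be the $3\times3$ permutation matrices of the corresponding transpositions, $\pi_{123}$ the $3\times 3$ permutation matrix with $\pi_{123}e_i=e_{i+1}$ (indices modulo $3$), $\varepsilon_1=\mathrm{diag}(-1,1,1)$, $\varepsilon_2=\mathrm{diag}(1,-1,1)$, and let $\pi'=\begin{pmatrix}0&1\\1&0\end{pmatrix}$, $\varepsilon'=\mathrm{diag}(-1,1)$, $d=\begin{pmatrix}0&-1\\1&-1\end{pmatrix}$. Let $x^t$ denote the transpose of $x$. Theorem. (1) $\mathcal H$ is an algorithm of length $15$ computing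 $\langle 3,2,3\rangle$. There are linear automorphisms $\Phi_1,\Phi_2,\Phi_3$ of $M_{32}\otimes M_{23}\otimes M_{33}$ such that, for all $x,y,z$, $$\Phi_1(x\otimes y\otimes z)=\pi_{123}xd^{-1}\otimes dy\pi_{123}^{-1}\otimes\pi_{123}z\pi_{123}^{-1},$$ $$\Phi_2(x\otimes y\otimes z)=\pi_{13}x\pi'\otimes\pi'y\pi_{13}\otimes\pi_{13}z\pi_{13},$$ $$\Phi_3(x\otimes y\otimes z)=y^t\pi'\varepsilon'\otimes\varepsilon'\pi'x^t\otimes z^t,$$ and $\mathrm{Aut}(\mathcal H)=\langle\Phi_1,\Phi_2,\Phi_3\rangle\cong S_3\times Z_2$. (2) $\mathcal L$ is an algorithm of length $23$ computing $\langle 3,3,3\rangle$. There are linear automorphisms $\Phi_1,\Phi_2,\Phi_3,\Phi_4$ of $M_{33}\otimes M_{33}\otimes M_{33}$ such that, for all $x,y,z$, $$\Phi_1(x\otimes y\otimes z)=\pi_{23}x\pi_{13}\otimes\pi_{13}y\otimes z\pi_{23},$$ $$\Phi_2(x\otimes y\otimes z)=\pi_{23}x\otimes y\pi_{23}\otimes\pi_{23}z\pi_{23},$$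 $$\Phi_3(x\otimes y\otimes z)=y^t\varepsilon_2\otimes\varepsilon_2x^t\otimes z^t,$$ $$\Phi_4(x\otimes y\otimes z)=\varepsilon_1z\pi_{12}\otimes\pi_{12}x\pi_{12}\varepsilon_1\otimes\varepsilon_1\pi_{12}y\varepsilon_1,$$ and $\mathrm{Aut}(\mathcal L)=\langle\Phi_1,\Phi_2,\Phi_3,\Phi_4\rangle\cong S_4$. -/

import Mathlib

open scoped TensorProduct Matrix

/-! ### Decomposable automorphisms of a tensor product and automorphisms of a set of tensors -/

section Decomposable

variable {K : Type*} [Field K] {ι : Type*} {V : ι → Type*}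
  [∀ i, AddCommGroup (V i)] [∀ i, Module K (V i)]

/-- The isomorphism `V i ≃ V j` that comes from an equality of indices. -/
def indexEquiv {i j : ι} (h : i = j) : V i ≃ₗ[K] V j := by
  subst h
  exact LinearEquiv.refl K (V i)

/-- `φ` is the decomposable automorphism of `⨂ i, V i` with data `(τ; f)`: it takes a pure tensor
`⨂ u i` to the pure tensor `⨂ v j` whose factor at the place `τ i` is `f i (u i)`. -/
def HasDecData (φ : (⨂[K] i, V i) ≃ₗ[K] (⨂[K] i, V i)) (τ : Equiv.Perm ι)
    (f : ∀ i, V i ≃ₗ[K] V (τ i)) : Prop :=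
  ∀ u v : ∀ i, V i, (∀ i, v (τ i) = f i (u i)) →
    φ (PiTensorProduct.tprod K u) = PiTensorProduct.tprod K v

variable (K V) in
/-- The group of all decomposable automorphisms of `⨂ i, V i`. -/
def decAut : Subgroup ((⨂[K] i, V i) ≃ₗ[K] (⨂[K] i, V i)) where
  carrier := {φ | ∃ (τ : Equiv.Perm ι) (f : ∀ i, V i ≃ₗ[K] V (τ i)), HasDecData φ τ f}
  one_mem' := by
    refine ⟨1, fun i => LinearEquiv.refl K (V i), fun u v h => ?_⟩
    have : v = u := funext h
    rw [this]
    rfl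
  mul_mem' := by
    rintro φ ψ ⟨σ, f, hf⟩ ⟨τ, g, hg⟩
    refine ⟨σ * τ, fun i => (g i).trans (f (τ i)), fun u v h => ?_⟩
    have hw : ∀ i, (f (τ i)).symm (v (σ (τ i))) = g i (u i) := fun i =>
      (LinearEquiv.symm_apply_eq _).2 (h i)
    rw [LinearEquiv.mul_apply, hg u (fun j => (f j).symm (v (σ j))) hw]
    exact hf _ _ fun j => ((f j).apply_symm_apply _).symm
  inv_mem' := by
    rintro φ ⟨τ, f, hf⟩
    refine ⟨τ⁻¹, fun j => (indexEquiv (τ.apply_symm_apply j).symm).trans (f (τ⁻¹ j)).symm,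
      fun u v h => ?_⟩
    have key : ∀ i, u (τ i) = f i (v i) := by
      intro i
      have aux : ∀ (j k : ι) (e : j = τ k), τ⁻¹ j = k → u j = indexEquiv (K := K) e.symm (f k (v k)) := by
        intro j k e hk
        subst hk
        rw [h j]
        simp only [LinearEquiv.trans_apply, LinearEquiv.apply_symm_apply]
        have back : ∀ (a b : ι) (p : a = b) (q : b = a) (x : V a),
            indexEquiv (K := K) q (indexEquiv (K := K) p x) = x := by
          intro a b p q x
          subst p
          rfl
        exact (back _ _ _ _ _).symm
      exact aux (τ i) i rfl (τ.symm_apply_apply i)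
    change φ.symm _ = _
    rw [LinearEquiv.symm_apply_eq]
    exact (hf v u key).symm

/-- The automorphism group of a set `A` of tensors: the decomposable automorphisms `φ` of the
ambient tensor product with `φ(A) = A`. -/
def autGroup (A : Set (⨂[K] i, V i)) : Subgroup ((⨂[K] i, V i) ≃ₗ[K] (⨂[K] i, V i)) where
  carrier := {φ | φ ∈ decAut K V ∧ φ '' A = A}
  one_mem' := ⟨one_mem _, Set.image_id A⟩
  mul_mem' := by
    rintro φ ψ ⟨hφ, hA⟩ ⟨hψ, hB⟩
    refine ⟨mul_mem hφ hψ, ?_⟩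
    change (fun x => φ (ψ x)) '' A = A
    rw [← Set.image_image, hB, hA]
  inv_mem' := by
    rintro φ ⟨hφ, hA⟩
    refine ⟨inv_mem hφ, ?_⟩
    change φ.symm '' A = A
    conv_lhs => rw [← hA]
    rw [Set.image_image]
    simp

/-- The `r` tensors `t 0, …, t (r - 1)` form an algorithm of length `r` computing the tensor `w`:
they are pairwise distinct decomposable tensors whose sum is `w`. -/
def IsAlgorithm {r : ℕ} (t : Fin r → ⨂[K] i, V i) (w : ⨂[K] i, V i) : Prop :=
  (∀ l, ∃ u : ∀ i, V i, t l = PiTensorProduct.tprod K u) ∧ Function.Injective t ∧ ∑ l, t l = w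

end Decomposable

/-! ### Matrix multiplication tensors -/

/-- For `d = ![m, n, p]` the three factors are the spaces of `m × n`, `n × p` and `p × m`
matrices. -/
abbrev MatFactor (K : Type*) (d : Fin 3 → ℕ) (i : Fin 3) : Type _ :=
  Matrix (Fin (d i)) (Fin (d (i + 1))) K

/-- `M_{mn}(K) ⊗ M_{np}(K) ⊗ M_{pm}(K)`. -/
abbrev MMSpace (K : Type*) [Field K] (m n p : ℕ) : Type _ :=
  ⨂[K] i, MatFactor K ![m, n, p] i

/-- The decomposable tensor `x ⊗ y ⊗ z`. -/
noncomputable def tri {K : Type*} [Field K] {m n p : ℕ} (x : Matrix (Fin m) (Fin n) K)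
    (y : Matrix (Fin n) (Fin p) K) (z : Matrix (Fin p) (Fin m) K) : MMSpace K m n p :=
  PiTensorProduct.tprod K fun i => match i with
    | 0 => x
    | 1 => y
    | 2 => z

/-- The matrix multiplication tensor `⟨m, n, p⟩ = ∑ e_{ij} ⊗ e_{jk} ⊗ e_{ki}`. -/
noncomputable def matMulTensor (K : Type*) [Field K] (m n p : ℕ) : MMSpace K m n p :=
  ∑ i : Fin m, ∑ j : Fin n, ∑ k : Fin p,
    tri (Matrix.single i j 1) (Matrix.single j k 1) (Matrix.single k i 1)

/-- The Hopcroft algorithm for multiplying a `3 × 2` matrix by a `2 × 3` matrix, in tensor form: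
the product `p_l = (∑ a_{ij} x_{ij}) (∑ b_{jk} y_{jk})`, which enters `z_{ik}` with coefficient
`c_{ik}`, gives the tensor `a ⊗ b ⊗ cᵀ`. -/
noncomputable def hopcroft (K : Type*) [Field K] : Fin 15 → MMSpace K 3 2 3 :=
  ![
    tri !![1, -1; 0, 0; 0, 0] !![1, 0, 0; 0, 0, 0] !![1, -1, 0; 0, 0, 0; -1, 0, 0],
    tri !![0, 1; 0, 0; 0, 0] !![1, 0, 0; 1, 0, 0] !![1, 0, -1; -1, 0, 0; 0, 0, 0],
    tri !![0, 0; 1, 0; 0, 0] !![0, 1, 0; 0, 0, 0] !![0, 0, 0; -1, 1, 0; 0, -1, 0],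
    tri !![0, 0; 0, 1; 0, 0] !![0, 0, 0; 0, 1, 0] !![0, -1, 0; 0, 1, -1; 0, 0, 0],
    tri !![0, 0; 0, 0; 1, 0] !![0, 0, 1; 0, 0, 1] !![0, 0, 0; 0, 0, -1; -1, 0, 1],
    tri !![0, 0; 0, 0; -1, 1] !![0, 0, 0; 0, 0, 1] !![0, 0, -1; 0, 0, 0; 0, -1, 1],
    tri !![1, 0; 1, 0; 0, 0] !![1, 1, 0; 1, 1, 0] !![0, 0, 0; 1, 0, 0; 0, 0, 0],
    tri !![1, -1; 1, 0; 0, 0] !![1, 0, 0; 1, 1, 0] !![0, 1, 0; -1, 0, 0; 0, 0, 0],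
    tri !![1, -1; 1, -1; 0, 0] !![0, 0, 0; 1, 1, 0] !![0, -1, 0; 0, 0, 0; 0, 0, 0],
    tri !![0, 0; 0, 1; 0, 1] !![0, 1, 1; 0, 1, 1] !![0, 0, 0; 0, 0, 1; 0, 0, 0],
    tri !![0, 0; 0, 1; -1, 1] !![0, 1, 1; 0, 0, 1] !![0, 0, 0; 0, 0, -1; 0, 1, 0],
    tri !![0, 0; -1, 1; -1, 1] !![0, 1, 1; 0, 0, 0] !![0, 0, 0; 0, 0, 0; 0, -1, 0],
    tri !![0, 1; 0, 0; 1, 0] !![1, 0, 0; 0, 0, -1] !![0, 0, 1; 0, 0, 0; -1, 0, 0],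
    tri !![0, 1; 0, 0; 0, 1] !![0, 0, 0; 1, 0, 1] !![0, 0, 1; 0, 0, 0; 0, 0, 0],
    tri !![1, 0; 0, 0; 1, 0] !![1, 0, 1; 0, 0, 0] !![0, 0, 0; 0, 0, 0; 1, 0, 0]]

/-- The Laderman algorithm for multiplying two `3 × 3` matrices, in tensor form. -/
noncomputable def laderman (K : Type*) [Field K] : Fin 23 → MMSpace K 3 3 3 :=
  ![
    tri !![1, 1, 1; -1, -1, 0; 0, -1, -1] !![0, 0, 0; 0, 1, 0; 0, 0, 0] !![0, 0, 0; 1, 0, 0; 0, 0, 0],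
    tri !![1, 0, 0; -1, 0, 0; 0, 0, 0] !![0, -1, 0; 0, 1, 0; 0, 0, 0] !![0, 1, 0; 0, 1, 0; 0, 0, 0],
    tri !![0, 0, 0; 0, 1, 0; 0, 0, 0] !![-1, 1, 0; 1, -1, -1; -1, 0, 1] !![0, 1, 0; 0, 0, 0; 0, 0, 0],
    tri !![-1, 0, 0; 1, 1, 0; 0, 0, 0] !![1, -1, 0; 0, 1, 0; 0, 0, 0] !![0, 1, 0; 1, 1, 0; 0, 0, 0],
    tri !![0, 0, 0; 1, 1, 0; 0, 0, 0] !![-1, 1, 0; 0, 0, 0; 0, 0, 0] !![0, 0, 0; 1, 1, 0; 0, 0, 0],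
    tri !![1, 0, 0; 0, 0, 0; 0, 0, 0] !![1, 0, 0; 0, 0, 0; 0, 0, 0] !![1, 1, 1; 1, 1, 0; 1, 0, 1],
    tri !![-1, 0, 0; 0, 0, 0; 1, 1, 0] !![1, 0, -1; 0, 0, 1; 0, 0, 0] !![0, 0, 1; 0, 0, 0; 1, 0, 1],
    tri !![-1, 0, 0; 0, 0, 0; 1, 0, 0] !![0, 0, 1; 0, 0, -1; 0, 0, 0] !![0, 0, 1; 0, 0, 0; 0, 0, 1],
    tri !![0, 0, 0; 0, 0, 0; 1, 1, 0] !![-1, 0, 1; 0, 0, 0; 0, 0, 0] !![0, 0, 0; 0, 0, 0; 1, 0, 1],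
    tri !![1, 1, 1; 0, -1, -1; -1, -1, 0] !![0, 0, 0; 0, 0, 1; 0, 0, 0] !![0, 0, 0; 0, 0, 0; 1, 0, 0],
    tri !![0, 0, 0; 0, 0, 0; 0, 1, 0] !![-1, 0, 1; 1, -1, -1; -1, 1, 0] !![0, 0, 1; 0, 0, 0; 0, 0, 0],
    tri !![0, 0, -1; 0, 0, 0; 0, 1, 1] !![0, 0, 0; 0, 1, 0; 1, -1, 0] !![0, 0, 1; 1, 0, 1; 0, 0, 0],
    tri !![0, 0, 1; 0, 0, 0; 0, 0, -1] !![0, 0, 0; 0, 1, 0; 0, -1, 0] !![0, 0, 1; 0, 0, 1; 0, 0, 0],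
    tri !![0, 0, 1; 0, 0, 0; 0, 0, 0] !![0, 0, 0; 0, 0, 0; 1, 0, 0] !![1, 1, 1; 1, 0, 1; 1, 1, 0],
    tri !![0, 0, 0; 0, 0, 0; 0, 1, 1] !![0, 0, 0; 0, 0, 0; -1, 1, 0] !![0, 0, 0; 1, 0, 1; 0, 0, 0],
    tri !![0, 0, -1; 0, 1, 1; 0, 0, 0] !![0, 0, 0; 0, 0, 1; 1, 0, -1] !![0, 1, 0; 0, 0, 0; 1, 1, 0],
    tri !![0, 0, 1; 0, 0, -1; 0, 0, 0] !![0, 0, 0; 0, 0, 1; 0, 0, -1] !![0, 1, 0; 0, 0, 0; 0, 1, 0],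
    tri !![0, 0, 0; 0, 1, 1; 0, 0, 0] !![0, 0, 0; 0, 0, 0; -1, 0, 1] !![0, 0, 0; 0, 0, 0; 1, 1, 0],
    tri !![0, 1, 0; 0, 0, 0; 0, 0, 0] !![0, 0, 0; 1, 0, 0; 0, 0, 0] !![1, 0, 0; 0, 0, 0; 0, 0, 0],
    tri !![0, 0, 0; 0, 0, 1; 0, 0, 0] !![0, 0, 0; 0, 0, 0; 0, 1, 0] !![0, 0, 0; 0, 1, 0; 0, 0, 0],
    tri !![0, 0, 0; 1, 0, 0; 0, 0, 0] !![0, 0, 1; 0, 0, 0; 0, 0, 0] !![0, 0, 0; 0, 0, 0; 0, 1, 0],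
    tri !![0, 0, 0; 0, 0, 0; 1, 0, 0] !![0, 1, 0; 0, 0, 0; 0, 0, 0] !![0, 0, 0; 0, 0, 1; 0, 0, 0],
    tri !![0, 0, 0; 0, 0, 0; 0, 0, 1] !![0, 0, 0; 0, 0, 0; 0, 0, 1] !![0, 0, 0; 0, 0, 0; 0, 0, 1]]

/-! ### The special matrices of the generators -/

section Special

variable (K : Type*) [Field K]

/-- The permutation matrix interchanging the first two of three basis vectors. -/
def pi12 : Matrix (Fin 3) (Fin 3) K := !![0, 1, 0; 1, 0, 0; 0, 0, 1]

/-- The permutation matrix interchanging the first and third basis vectors. -/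
def pi13 : Matrix (Fin 3) (Fin 3) K := !![0, 0, 1; 0, 1, 0; 1, 0, 0]

/-- The permutation matrix interchanging the last two of three basis vectors. -/
def pi23 : Matrix (Fin 3) (Fin 3) K := !![1, 0, 0; 0, 0, 1; 0, 1, 0]

/-- The permutation matrix of the cycle `1 ↦ 2 ↦ 3 ↦ 1`. -/
def pi123 : Matrix (Fin 3) (Fin 3) K := !![0, 0, 1; 1, 0, 0; 0, 1, 0]

/-- The diagonal matrix `diag(-1, 1, 1)`. -/
def eps1 : Matrix (Fin 3) (Fin 3) K := Matrix.diagonal ![-1, 1, 1]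

/-- The diagonal matrix `diag(1, -1, 1)`. -/
def eps2 : Matrix (Fin 3) (Fin 3) K := Matrix.diagonal ![1, -1, 1]

/-- The `2 × 2` permutation matrix interchanging the two basis vectors. -/
def sq12 : Matrix (Fin 2) (Fin 2) K := !![0, 1; 1, 0]

/-- The `2 × 2` diagonal matrix `diag(-1, 1)`. -/
def sqEps1 : Matrix (Fin 2) (Fin 2) K := Matrix.diagonal ![-1, 1]

/-- The `2 × 2` matrix `d` of order three. -/
def sqD : Matrix (Fin 2) (Fin 2) K := !![0, -1; 1, -1]

end Special

/-! ### Pure tensors and decomposable automorphisms -/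

/-! The group is bounded from above through the linear dependencies among the factors of the
tensors, and from below by exhibiting generators.

Let `φ` be a decomposable automorphism with data `(τ; f)` that preserves the set of tensors. It
permutes them by some `σ`. The factors of a nonzero pure tensor are determined up to scalars with
product `1` (`exists_smul_of_tprod_eq`), so each `f i` takes the matrix of the `l`-th tensor in
factor `i` to a multiple of the matrix of the `σ l`-th tensor in factor `τ i`. Call three matrices
of one factor a line if they satisfy a linear relation with no zero coefficient. Then `σ` carries
lines of factor `i` to lines of factor `τ i` (`LineScheme.thirdPoint_map`). The lines are the same
over every field: those present come from relations with coefficients `±1`, and those absent are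
excluded by an entry or a `3 × 3` minor equal to `±1` (`LineScheme`).

What remains is a finite problem. For each `τ`, a search guesses the images of two or three tensors
and propagates them along lines (`searchAll_sound`). It shows that `σ` acts on six tensors of the
Hopcroft algorithm as a symmetry in `S₃ × Z₂` of a prism, and permutes four tensors of the Laderman
algorithm. It also shows that if these are fixed, then `τ` is trivial and `σ` fixes all tensors that
are needed later.

In the latter case every matrix concerned is an eigenvector of `f i`. A line forces equal
eigenvalues at its three points, so eigenvalues spread along connected lines; where two factors are
settled, the third follows from the product being `1`. The matrices reached span each factor, so
every `f i` is a scalar and `φ = 1` (`LineScheme.eq_one_of_fixed`). Thus the group embeds into `S₃ ×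
Z₂` or `S₄`. The explicit automorphisms act as generators there, which gives both the generation
statement and the isomorphism (`closure_eq_and_nonempty_mulEquiv`). -/

/-- A family `v` with prescribed entries at the places `τ i`. -/
theorem exists_family_of_perm {ι : Type*} {V : ι → Type*} (τ : Equiv.Perm ι) (w : ∀ i, V (τ i)) :
    ∃ v : ∀ i, V i, ∀ i, v (τ i) = w i :=
  ⟨Equiv.piCongrLeft V τ w, fun i => Equiv.piCongrLeft_apply_apply V τ w i⟩

section PureTensor

variable {K : Type*} [Field K] {ι : Type*} {V : ι → Type*}
  [∀ i, AddCommGroup (V i)] [∀ i, Module K (V i)]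

/-- A product of functionals, one on each factor, is well defined on the tensor product, so it
cannot distinguish the two families. Functionals `g i` with value `1` at `u i` yield the scalars `g
i (v i)`. -/
theorem exists_smul_of_tprod_eq [Fintype ι] [DecidableEq ι] {u v : ∀ i, V i} (hu : ∀ i, u i ≠ 0)
    (h : PiTensorProduct.tprod K u = PiTensorProduct.tprod K v) :
    ∃ c : ι → K, (∀ i, v i = c i • u i) ∧ ∏ i, c i = 1 := by
  choose g hg using fun i => Module.Projective.exists_dual_eq_one K (hu i)
  have key : ∀ f : ∀ i, Module.Dual K (V i), ∏ i, f i (u i) = ∏ i, f i (v i) := by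
    intro f
    have := congrArg (PiTensorProduct.lift
      ((MultilinearMap.mkPiAlgebra K ι K).compLinearMap f)) h
    simpa using this
  have hprod : ∏ i, g i (v i) = 1 := by
    rw [← key g]
    simp [hg]
  refine ⟨fun i => g i (v i), fun i => ?_, hprod⟩
  by_contra hne
  obtain ⟨f, hf⟩ := Module.Projective.exists_dual_eq_one K (sub_ne_zero.2 hne)
  -- The new functional at `i` kills `u i`, but equals `f (v i - g i (v i) • u i) = 1` at `v i`; so
  -- exactly one of the two products vanishes.
  have e := key (Function.update g i (f - f (u i) • g i))
  have hl : ∏ j, Function.update g i (f - f (u i) • g i) j (u j) = 0 :=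
    Finset.prod_eq_zero (Finset.mem_univ i) (by simp [hg])
  have hr : ∏ j, Function.update g i (f - f (u i) • g i) j (v j) ≠ 0 := by
    rw [Finset.prod_ne_zero_iff]
    intro j _
    rcases eq_or_ne j i with rfl | hj
    · have : f (v j) - g j (v j) * f (u j) = 1 := by simpa using hf
      simp only [Function.update_self, LinearMap.sub_apply, LinearMap.smul_apply, smul_eq_mul]
      rw [mul_comm, this]
      exact one_ne_zero
    · rw [Function.update_of_ne hj]
      exact Finset.prod_ne_zero_iff.1 (by rw [hprod]; exact one_ne_zero) j (Finset.mem_univ j)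
  exact hr (e ▸ hl)

theorem exists_hasDecData (τ : Equiv.Perm ι) (f : ∀ i, V i ≃ₗ[K] V (τ i)) :
    ∃ φ : (⨂[K] i, V i) ≃ₗ[K] (⨂[K] i, V i), HasDecData φ τ f := by
  refine ⟨(PiTensorProduct.congr f).trans (PiTensorProduct.reindex K V τ.symm).symm,
    fun u v h => ?_⟩
  rw [LinearEquiv.trans_apply, LinearEquiv.symm_apply_eq, PiTensorProduct.congr_tprod,
    PiTensorProduct.reindex_tprod]
  congr 1
  exact funext fun i => (h i).symm

theorem eq_one_of_hasDecData_smul [Fintype ι] {φ : (⨂[K] i, V i) ≃ₗ[K] (⨂[K] i, V i)}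
    {f : ∀ i, V i ≃ₗ[K] V i} (h : HasDecData φ 1 f) {C : ι → K}
    (hf : ∀ i u, f i u = C i • u) (hC : ∏ i, C i = 1) : φ = 1 := by
  refine LinearEquiv.toLinearMap_injective (PiTensorProduct.ext (MultilinearMap.ext fun u => ?_))
  have := h u (fun i => C i • u i) fun i => (hf i (u i)).symm
  rw [MultilinearMap.map_smul_univ, hC, one_smul] at this
  exact this

/-- An automorphism of a finite set of nonzero pure tensors permutes them, up to scalars factor by
factor. -/
theorem exists_perm_of_mem_autGroup [Fintype ι] [DecidableEq ι] {r : ℕ} {x : Fin r → ∀ i, V i}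
    (hx : ∀ l i, x l i ≠ 0)
    (hinj : Function.Injective fun l => PiTensorProduct.tprod K (x l))
    {φ : (⨂[K] i, V i) ≃ₗ[K] (⨂[K] i, V i)}
    (hφ : φ ∈ autGroup (Set.range fun l => PiTensorProduct.tprod K (x l))) :
    ∃ (τ : Equiv.Perm ι) (f : ∀ i, V i ≃ₗ[K] V (τ i)) (σ : Fin r → Fin r) (c : Fin r → ι → K),
      HasDecData φ τ f ∧ Function.Injective σ ∧
      (∀ l, φ (PiTensorProduct.tprod K (x l)) = PiTensorProduct.tprod K (x (σ l))) ∧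
      (∀ l i, f i (x l i) = c l i • x (σ l) (τ i)) ∧ ∀ l, ∏ i, c l i = 1 := by
  obtain ⟨⟨τ, f, hf⟩, himg⟩ := hφ
  have hσ : ∀ l, ∃ m, φ (PiTensorProduct.tprod K (x l)) = PiTensorProduct.tprod K (x m) := by
    intro l
    have : φ (PiTensorProduct.tprod K (x l)) ∈
        Set.range fun l => PiTensorProduct.tprod K (x l) := by
      rw [← himg]
      exact ⟨_, ⟨l, rfl⟩, rfl⟩
    obtain ⟨m, hm⟩ := this
    exact ⟨m, hm.symm⟩
  choose σ hσ using hσ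
  -- The image of a tensor has two factorizations, one through `f` and one as a member of the set.
  -- The scalars comparing them are indexed by target places; reindexing by `τ` keeps their product.
  have hc : ∀ l, ∃ c : ι → K, (∀ i, f i (x l i) = c i • x (σ l) (τ i)) ∧ ∏ i, c i = 1 := by
    intro l
    obtain ⟨v, hv⟩ := exists_family_of_perm τ fun i => f i (x l i)
    have e := (hσ l).symm.trans (hf (x l) v hv)
    obtain ⟨c, hcv, hc⟩ := exists_smul_of_tprod_eq (hx (σ l)) e
    refine ⟨fun i => c (τ i), fun i => ?_, ?_⟩
    · rw [← hv, hcv]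
    · rw [← hc]
      exact Equiv.prod_comp τ c
  choose c hc hc1 using hc
  refine ⟨τ, f, σ, c, hf, fun a b hab => hinj (φ.injective ?_), hσ, hc, hc1⟩
  change φ _ = φ _
  rw [hσ, hσ, hab]

end PureTensor

/-! ### Collinear triples of vectors -/

section Collinear

variable {K : Type*} [Field K] {V W : Type*} [AddCommGroup V] [Module K V] [AddCommGroup W]
  [Module K W]

variable (K) in
/-- The vectors `u, v, w` satisfy a linear relation in which every coefficient is nonzero. -/
def LinRel (u v w : V) : Prop :=
  ∃ α β γ : K, α ≠ 0 ∧ β ≠ 0 ∧ γ ≠ 0 ∧ α • u + β • v + γ • w = 0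

theorem LinRel.swap_left {u v w : V} (h : LinRel K u v w) : LinRel K v u w := by
  obtain ⟨α, β, γ, hα, hβ, hγ, h⟩ := h
  exact ⟨β, α, γ, hβ, hα, hγ, by rw [add_comm (β • v), h]⟩

theorem LinRel.swap_right {u v w : V} (h : LinRel K u v w) : LinRel K u w v := by
  obtain ⟨α, β, γ, hα, hβ, hγ, h⟩ := h
  exact ⟨α, γ, β, hα, hγ, hβ, by rw [add_right_comm, h]⟩

/-- Nonzero scalars are absorbed into the coefficients, so the relation depends only on the points
of projective space. -/
theorem LinRel.map {u v w : V} {u' v' w' : W} {f : V ≃ₗ[K] W} {a b c : K} (ha : a ≠ 0)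
    (hb : b ≠ 0) (hc : c ≠ 0) (hu : f u = a • u') (hv : f v = b • v') (hw : f w = c • w')
    (h : LinRel K u v w) : LinRel K u' v' w' := by
  obtain ⟨α, β, γ, hα, hβ, hγ, h⟩ := h
  refine ⟨α * a, β * b, γ * c, mul_ne_zero hα ha, mul_ne_zero hβ hb, mul_ne_zero hγ hc, ?_⟩
  have := congrArg f h
  simpa [hu, hv, hw, smul_smul] using this

/-- A linear map for which the three vectors of a linear relation are eigenvectors has the same
eigenvalue at all three, provided that two of the vectors are independent. -/
theorem LinRel.eigenvalue_eq {u v w : V} {f : V ≃ₗ[K] V} {a b c : K} (hu : f u = a • u)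
    (hv : f v = b • v) (hw : f w = c • w)
    (huv : ∀ α β : K, α • u + β • v = 0 → α = 0 ∧ β = 0) (h : LinRel K u v w) :
    a = c ∧ b = c := by
  obtain ⟨α, β, γ, hα, hβ, hγ, h⟩ := h
  have h2 := congrArg f h
  simp only [map_add, map_smul, hu, hv, hw, map_zero] at h2
  -- Subtracting `c` times the relation from its image under `f` eliminates `w`.
  have h3 : (α * (a - c)) • u + (β * (b - c)) • v = 0 := by
    have : (α * (a - c)) • u + (β * (b - c)) • v =
      (α • a • u + β • b • v + γ • c • w) - c • (α • u + β • v + γ • w) := by module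
    rw [this, h, h2, smul_zero, sub_zero]
  obtain ⟨h4, h5⟩ := huv _ _ h3
  exact ⟨sub_eq_zero.1 ((mul_eq_zero.1 h4).resolve_left hα),
    sub_eq_zero.1 ((mul_eq_zero.1 h5).resolve_left hβ)⟩

end Collinear

/-! ### Recognizing a group by its action on some of the points -/

/-- If `p` and `q` are both related to `g`, and `s` to `g⁻¹`, then `s * p` and `s * q` are related
to `1`, hence `s * p = 1 = s * q`. So the relation is the graph of a homomorphism. -/
theorem exists_monoidHom_of_rel {G P : Type*} [Group G] [Group P] (R : G → P → Prop)
    (tot : ∀ g, ∃ p, R g p) (mul : ∀ {g h p q}, R g p → R h q → R (g * h) (p * q))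
    (one : ∀ p, R 1 p → p = 1) : ∃ F : G →* P, ∀ g p, R g p ↔ p = F g := by
  have uniq : ∀ g p q, R g p → R g q → p = q := by
    intro g p q hp hq
    obtain ⟨s, hs⟩ := tot g⁻¹
    have h1 := one _ (inv_mul_cancel g ▸ mul hs hp)
    have h2 := one _ (inv_mul_cancel g ▸ mul hs hq)
    exact mul_left_cancel (h1.trans h2.symm)
  choose F hF using tot
  exact ⟨MonoidHom.mk' F fun g h => uniq _ _ _ (hF _) (mul (hF g) (hF h)),
    fun g p => ⟨fun h => uniq _ _ _ h (hF g), fun h => h ▸ hF g⟩⟩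

/-- Let `A` be a group of permutations of `E` such that every element of `A` acts on the points
`t w` as some element of `P`, and only the identity fixes all of them. If elements of `S ⊆ A` act
as generators of `P`, then `S` generates `A`, and `A` is isomorphic to `P`. -/
theorem closure_eq_and_nonempty_mulEquiv {L E P Ω : Type*} [Group L] [MulAction L E] [Group P]
    {A : Subgroup L} {t : Ω → E} (ht : Function.Injective t) {act : P →* Equiv.Perm Ω}
    (hact : Function.Injective act)
    (h1 : ∀ φ ∈ A, ∃ p : P, ∀ w, φ • t w = t (act p w))
    (h2 : ∀ φ ∈ A, (∀ w, φ • t w = t w) → φ = 1)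
    {S : Set L} (hS : S ⊆ A) {Q : Set P} (hQ : Subgroup.closure Q = ⊤)
    (hSQ : ∀ q ∈ Q, ∃ φ ∈ S, ∀ w, φ • t w = t (act q w)) :
    A = Subgroup.closure S ∧ Nonempty (A ≃* P) := by
  obtain ⟨F, hF⟩ := exists_monoidHom_of_rel
    (fun (φ : A) (p : P) => ∀ w, (φ : L) • t w = t (act p w))
    (fun φ => h1 φ φ.2)
    (fun {g h p q} hg hh w => by
      rw [Subgroup.coe_mul, mul_smul, map_mul, Equiv.Perm.mul_apply, hh, hg])
    (fun p hp => hact (Equiv.ext fun w => by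
      rw [map_one, Equiv.Perm.one_apply]
      refine ht ?_
      rw [← hp w, Subgroup.coe_one, one_smul]))
  have hinj : Function.Injective F := by
    rw [injective_iff_map_eq_one]
    intro φ hφ
    refine Subtype.ext (h2 φ φ.2 fun w => ?_)
    have := (hF φ 1).2 hφ.symm w
    rwa [map_one, Equiv.Perm.one_apply] at this
  -- The subgroup generated by `S` already maps onto `P`. As `F` is injective on `A`, this subgroup
  -- is all of `A`.
  have hcl : (⊤ : Subgroup P) ≤ ((Subgroup.closure S).subgroupOf A).map F := by
    rw [← hQ, Subgroup.closure_le]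
    intro q hq
    obtain ⟨φ, hφ, h⟩ := hSQ q hq
    exact ⟨⟨φ, hS hφ⟩, Subgroup.subset_closure hφ, ((hF ⟨φ, hS hφ⟩ q).1 h).symm⟩
  refine ⟨le_antisymm (fun φ hφ => ?_) ((Subgroup.closure_le A).2 hS), ⟨MulEquiv.ofBijective F
    ⟨hinj, fun p => ?_⟩⟩⟩
  · obtain ⟨ψ, hψ, e⟩ := hcl (Subgroup.mem_top (F ⟨φ, hφ⟩))
    have := hinj e
    rw [this] at hψ
    exact hψ
  · obtain ⟨ψ, -, e⟩ := hcl (Subgroup.mem_top p)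
    exact ⟨ψ, e⟩

/-! ### Matrices with integer entries given by lists -/

section FlatMatrix

/-- The `m × n` matrix whose rows, one after the other, form the list `u` of integers. -/
def flatMat (R : Type*) [Ring R] (m n : ℕ) (u : List ℤ) : Matrix (Fin m) (Fin n) R :=
  Matrix.of fun p q => ((u.getD (q + n * p) 0 : ℤ) : R)

theorem flatMat_apply {R : Type*} [Ring R] {m n : ℕ} (u : List ℤ) (p : Fin m) (q : Fin n) :
    flatMat R m n u p q = ((u.getD (q + n * p) 0 : ℤ) : R) := rfl

theorem exists_flat_index {m n k : ℕ} (hk : k < m * n) : ∃ (p : Fin m) (q : Fin n),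
    (q : ℕ) + n * p = k := by
  obtain ⟨⟨p, q⟩, h⟩ := finProdFinEquiv.surjective (⟨k, hk⟩ : Fin (m * n))
  exact ⟨p, q, congrArg Fin.val h⟩

theorem flat_index_injective {m n : ℕ} {p p' : Fin m} {q q' : Fin n}
    (h : (q : ℕ) + n * p = q' + n * p') : p = p' ∧ q = q' := by
  have : finProdFinEquiv (p, q) = finProdFinEquiv (p', q') := Fin.ext h
  simpa using this

variable {K : Type*} [Field K]

/-- Only `±1` are nonzero in every field, which is why all certificates ask for absolute value `1`.
-/
theorem intCast_ne_zero_of_natAbs_eq_one {a : ℤ} (h : a.natAbs = 1) : (a : K) ≠ 0 := by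
  rcases Int.natAbs_eq_iff.1 h with rfl | rfl <;> simp

/-- Some `2 × 2` minor of the matrix with rows `u, v` is a unit. -/
def indepPair (u v : List ℤ) : Bool :=
  (u.zip v).any fun a => (u.zip v).any fun b => (a.1 * b.2 - b.1 * a.2).natAbs == 1

/-- Some entry is nonzero in exactly one of the three lists. -/
def hasLoneEntry : List ℤ → List ℤ → List ℤ → Bool
  | x :: u, y :: v, z :: w =>
    (x.natAbs == 1 && y == 0 && z == 0) || (x == 0 && y.natAbs == 1 && z == 0) ||
      (x == 0 && y == 0 && z.natAbs == 1) || hasLoneEntry u v w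
  | _, _, _ => false

/-- Some `3 × 3` minor of the matrix with rows `u, v, w` is a unit. -/
def hasUnitMinor (u v w : List ℤ) : Bool :=
  let cols := u.zip (v.zip w)
  cols.any fun a => cols.any fun b => cols.any fun c =>
    (a.1 * (b.2.1 * c.2.2 - c.2.1 * b.2.2) - b.1 * (a.2.1 * c.2.2 - c.2.1 * a.2.2) +
      c.1 * (a.2.1 * b.2.2 - b.2.1 * a.2.2)).natAbs == 1

/-- A certificate that `u, v, w` satisfy no linear relation without zero coefficients. -/
def noLinRel (u v w : List ℤ) : Bool := hasLoneEntry u v w || hasUnitMinor u v w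

/-- `u ± v ± w = 0` for some choice of the signs. -/
def hasSignRel (u v w : List ℤ) : Bool :=
  [1, -1].any fun s => [1, -1].any fun t =>
    (List.range u.length).all fun k => u.getD k 0 + s * v.getD k 0 + t * w.getD k 0 == 0

/-! ### Soundness of the integer certificates over a field -/

theorem mem_zip_getD {α β : Type*} {u : List α} {v : List β} {a : α × β} (h : a ∈ u.zip v)
    (x : α) (y : β) : ∃ k, k < u.length ∧ k < v.length ∧ u.getD k x = a.1 ∧ v.getD k y = a.2 := by
  obtain ⟨k, hk, e⟩ := List.mem_iff_getElem.1 h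
  rw [List.length_zip, lt_min_iff] at hk
  refine ⟨k, hk.1, hk.2, ?_, ?_⟩
  · rw [List.getD_eq_getElem _ _ hk.1, ← e, List.getElem_zip]
  · rw [List.getD_eq_getElem _ _ hk.2, ← e, List.getElem_zip]

theorem indepPair_sound {u v : List ℤ} (h : indepPair u v = true) {α β : K}
    (hrel : ∀ k, k < u.length → α * (u.getD k 0 : ℤ) + β * (v.getD k 0 : ℤ) = 0) :
    α = 0 ∧ β = 0 := by
  simp only [indepPair, List.any_eq_true, beq_iff_eq] at h
  obtain ⟨a, ha, b, hb, hab⟩ := h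
  obtain ⟨k, hk, -, ha1, ha2⟩ := mem_zip_getD ha 0 0
  obtain ⟨l, hl, -, hb1, hb2⟩ := mem_zip_getD hb 0 0
  have h1 := hrel k hk
  have h2 := hrel l hl
  rw [ha1, ha2] at h1
  rw [hb1, hb2] at h2
  have hne : ((a.1 : K) * b.2 - b.1 * a.2) ≠ 0 := by
    have := intCast_ne_zero_of_natAbs_eq_one (K := K) hab
    push_cast at this
    exact this
  constructor
  · refine (mul_eq_zero.1 ?_).resolve_right hne
    linear_combination (b.2 : K) * h1 - (a.2 : K) * h2
  · refine (mul_eq_zero.1 ?_).resolve_right hne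
    linear_combination (a.1 : K) * h2 - (b.1 : K) * h1

/-- At the lone entry the relation reduces to a single term, a nonzero coefficient times `±1`. -/
theorem hasLoneEntry_sound {α β γ : K} (hα : α ≠ 0) (hβ : β ≠ 0) (hγ : γ ≠ 0) :
    ∀ {u v w : List ℤ}, hasLoneEntry u v w = true →
      ¬ ∀ k, k < u.length → α * (u.getD k 0 : ℤ) + β * (v.getD k 0 : ℤ) + γ * (w.getD k 0 : ℤ) = 0
  | x :: u, y :: v, z :: w => by
    intro h hrel
    have h0 := hrel 0 (by simp)
    simp only [List.getD_cons_zero] at h0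
    simp only [hasLoneEntry, Bool.or_eq_true, Bool.and_eq_true, beq_iff_eq] at h
    rcases h with ((⟨⟨h1, rfl⟩, rfl⟩ | ⟨⟨rfl, h1⟩, rfl⟩) | ⟨⟨rfl, rfl⟩, h1⟩) | h
    · exact mul_ne_zero hα (intCast_ne_zero_of_natAbs_eq_one h1) (by simpa using h0)
    · exact mul_ne_zero hβ (intCast_ne_zero_of_natAbs_eq_one h1) (by simpa using h0)
    · exact mul_ne_zero hγ (intCast_ne_zero_of_natAbs_eq_one h1) (by simpa using h0)
    · refine hasLoneEntry_sound hα hβ hγ h fun k hk => ?_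
      have := hrel (k + 1) (by simpa using hk)
      simpa only [List.getD_cons_succ] using this
  | [], _, _ => by simp [hasLoneEntry]
  | _ :: _, [], _ => by simp [hasLoneEntry]
  | _ :: _, _ :: _, [] => by simp [hasLoneEntry]

/-- Expanding along the three columns of the minor, as in Cramer's rule, gives `α` times the minor
equal to zero. -/
theorem hasUnitMinor_sound {u v w : List ℤ} (h : hasUnitMinor u v w = true) {α β γ : K}
    (hα : α ≠ 0) :
    ¬ ∀ k, k < u.length →
      α * (u.getD k 0 : ℤ) + β * (v.getD k 0 : ℤ) + γ * (w.getD k 0 : ℤ) = 0 := by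
  intro hrel
  simp only [hasUnitMinor, List.any_eq_true, beq_iff_eq] at h
  obtain ⟨a, ha, b, hb, c, hc, habc⟩ := h
  have key : ∀ a ∈ u.zip (v.zip w), α * (a.1 : K) + β * a.2.1 + γ * a.2.2 = 0 := by
    intro a ha
    obtain ⟨k, hk, hk', h1, h2⟩ := mem_zip_getD ha 0 (0, 0)
    have hmem : a.2 ∈ v.zip w := (List.of_mem_zip (a := a.1) (b := a.2) ha).2
    have hk2 : k < v.length ∧ k < w.length := by
      rwa [List.length_zip, lt_min_iff] at hk'
    have := hrel k hk
    rw [List.getD_eq_getElem _ _ hk', List.getElem_zip] at h2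
    have e1 : v[k] = a.2.1 := congrArg Prod.fst h2
    have e2 : w[k] = a.2.2 := congrArg Prod.snd h2
    rwa [List.getD_eq_getElem v _ hk2.1, List.getD_eq_getElem w _ hk2.2, h1, e1, e2] at this
  have h1 := key a ha
  have h2 := key b hb
  have h3 := key c hc
  have hne := intCast_ne_zero_of_natAbs_eq_one (K := K) habc
  push_cast at hne
  refine mul_ne_zero hα hne ?_
  linear_combination ((b.2.1 : K) * c.2.2 - c.2.1 * b.2.2) * h1 -
    ((a.2.1 : K) * c.2.2 - c.2.1 * a.2.2) * h2 + ((a.2.1 : K) * b.2.2 - b.2.1 * a.2.2) * h3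

theorem noLinRel_sound {m n : ℕ} {u v w : List ℤ} (hu : u.length = m * n)
    (h : noLinRel u v w = true) :
    ¬ LinRel K (flatMat K m n u) (flatMat K m n v) (flatMat K m n w) := by
  rintro ⟨α, β, γ, hα, hβ, hγ, hrel⟩
  have hrel' : ∀ k, k < u.length →
      α * (u.getD k 0 : ℤ) + β * (v.getD k 0 : ℤ) + γ * (w.getD k 0 : ℤ) = 0 := by
    intro k hk
    obtain ⟨p, q, rfl⟩ := exists_flat_index (hu ▸ hk)
    exact congrFun (congrFun hrel p) q
  rw [noLinRel, Bool.or_eq_true] at h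
  rcases h with h | h
  · exact hasLoneEntry_sound hα hβ hγ h hrel'
  · exact hasUnitMinor_sound h hα hrel'

theorem indepPair_flatMat {m n : ℕ} {u v : List ℤ} (hu : u.length = m * n)
    (h : indepPair u v = true) (α β : K)
    (hrel : α • flatMat K m n u + β • flatMat K m n v = 0) : α = 0 ∧ β = 0 := by
  refine indepPair_sound h fun k hk => ?_
  obtain ⟨p, q, rfl⟩ := exists_flat_index (hu ▸ hk)
  exact congrFun (congrFun hrel p) q

theorem hasSignRel_sound {m n : ℕ} {u v w : List ℤ} (hu : u.length = m * n)
    (h : hasSignRel u v w = true) :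
    LinRel K (flatMat K m n u) (flatMat K m n v) (flatMat K m n w) := by
  simp only [hasSignRel, List.any_eq_true, List.all_eq_true, beq_iff_eq, List.mem_range] at h
  obtain ⟨s, hs, t, ht, h⟩ := h
  have hsgn : ∀ x ∈ [(1 : ℤ), -1], (x : K) ≠ 0 := by
    intro x hx
    simp only [List.mem_cons, List.not_mem_nil, or_false] at hx
    rcases hx with rfl | rfl <;> simp
  refine ⟨1, s, t, one_ne_zero, hsgn s hs, hsgn t ht, ?_⟩
  ext p q
  have hk : (q : ℕ) + n * p < u.length := hu ▸ (finProdFinEquiv (p, q)).2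
  have := congrArg (Int.cast : ℤ → K) (h _ hk)
  push_cast at this
  simpa [flatMat_apply] using this

/-- Each step `(u, k)` shows that the matrix unit with flat index `k` is a combination of `u` and
earlier matrix units. -/
def triangular : List (List ℤ × ℕ) → List ℕ → List ℕ
  | [], known => known
  | (u, k) :: S, known =>
    if (u.getD k 0).natAbs == 1 &&
      (List.range u.length).all (fun j => j == k || known.contains j || u.getD j 0 == 0)
    then triangular S (k :: known) else triangular S known

/-- Gaussian elimination with pivots `±1`: in the expansion of `g u = 0` every term but the pivot is
known to vanish. A step that fails the test adds nothing to the list, so soundness needs no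
assumption on the steps beyond `g` killing the matrices. -/
theorem triangular_sound {m n : ℕ} {W : Type*} [AddCommGroup W] [Module K W]
    (g : Matrix (Fin m) (Fin n) K →ₗ[K] W) :
    ∀ (S : List (List ℤ × ℕ)) (known : List ℕ),
      (∀ s ∈ S, s.1.length = m * n ∧ g (flatMat K m n s.1) = 0) →
      (∀ (p : Fin m) (q : Fin n), (q : ℕ) + n * p ∈ known → g (Matrix.single p q 1) = 0) →
      ∀ (p : Fin m) (q : Fin n), (q : ℕ) + n * p ∈ triangular S known →
        g (Matrix.single p q 1) = 0
  | [], _, _, hk => hk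
  | (u, k) :: S, known, hS, hk => by
    have hS' : ∀ s ∈ S, s.1.length = m * n ∧ g (flatMat K m n s.1) = 0 :=
      fun s hs => hS s (List.mem_cons_of_mem _ hs)
    rw [triangular]
    split_ifs with h
    swap
    · exact triangular_sound g S known hS' hk
    simp only [Bool.and_eq_true, List.all_eq_true, List.mem_range, Bool.or_eq_true, beq_iff_eq,
      List.contains_iff_mem] at h
    obtain ⟨hu1, hu⟩ := h
    obtain ⟨hlen, hgu⟩ := hS (u, k) List.mem_cons_self
    refine triangular_sound g S (k :: known) hS' fun p q hpq => ?_
    rcases List.mem_cons.1 hpq with hpq | hpq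
    swap
    · exact hk p q hpq
    have hsum : ∑ i : Fin m, ∑ j : Fin n,
        ((u.getD (j + n * i) 0 : ℤ) : K) • g (Matrix.single i j 1) = 0 := by
      rw [← hgu, Matrix.matrix_eq_sum_single (flatMat K m n u)]
      simp only [map_sum]
      refine Finset.sum_congr rfl fun i _ => Finset.sum_congr rfl fun j _ => ?_
      rw [← map_smul, Matrix.smul_single, smul_eq_mul, mul_one]
      rfl
    have hterm : ∀ (i : Fin m) (j : Fin n), (i, j) ≠ (p, q) →
        ((u.getD (j + n * i) 0 : ℤ) : K) • g (Matrix.single i j 1) = 0 := by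
      intro i j hij
      have hlt : (j : ℕ) + n * i < u.length := by
        rw [hlen]
        exact (finProdFinEquiv (i, j)).2
      rcases hu _ hlt with (h1 | h1) | h1
      · obtain ⟨rfl, rfl⟩ := flat_index_injective (h1.trans hpq.symm)
        exact absurd rfl hij
      · rw [hk i j h1, smul_zero]
      · rw [h1, Int.cast_zero, zero_smul]
    rw [Finset.sum_eq_single p, Finset.sum_eq_single q, hpq] at hsum
    · exact (smul_eq_zero.1 hsum).resolve_left (intCast_ne_zero_of_natAbs_eq_one hu1)
    · exact fun j _ hj => hterm p j fun h => hj (congrArg Prod.snd h)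
    · exact fun h => absurd (Finset.mem_univ q) h
    · exact fun i _ hi => Finset.sum_eq_zero fun j _ =>
        hterm i j fun h => hi (congrArg Prod.fst h)
    · exact fun h => absurd (Finset.mem_univ p) h

theorem linearMap_eq_zero_of_triangular {m n : ℕ} {W : Type*} [AddCommGroup W] [Module K W]
    (g : Matrix (Fin m) (Fin n) K →ₗ[K] W) {S : List (List ℤ × ℕ)}
    (hS : ∀ s ∈ S, s.1.length = m * n ∧ g (flatMat K m n s.1) = 0)
    (hall : ∀ k < m * n, k ∈ triangular S []) : g = 0 := by
  refine LinearMap.ext fun x => ?_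
  rw [LinearMap.zero_apply, Matrix.matrix_eq_sum_single x]
  simp only [map_sum]
  refine Finset.sum_eq_zero fun p _ => Finset.sum_eq_zero fun q _ => ?_
  have h := triangular_sound g S [] hS (by simp) p q (hall _ (finProdFinEquiv (p, q)).2)
  rw [← mul_one (x p q), ← smul_eq_mul, ← Matrix.smul_single, map_smul, h, smul_zero]

end FlatMatrix

/-! ### A search through the injective maps that preserve lines -/

section Search

/-- The third point of the line of `L` through `a` and `b`. -/
def thirdPoint : List (ℕ × ℕ × ℕ) → ℕ → ℕ → Option ℕ
  | [], _, _ => none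
  | (x, y, z) :: L, a, b =>
    if a == x && b == y then some z else if a == y && b == x then some z
    else if a == x && b == z then some y else if a == z && b == x then some y
    else if a == y && b == z then some x else if a == z && b == y then some x
    else thirdPoint L a b

/-- A step of the search: try all images of a point, or use a line `{a, b, c}` of the `i`-th
system to find the image of `c` from those of `a` and `b`. -/
inductive SearchStep
  | guess (a : ℕ)
  | line (i : Fin 3) (a b c : ℕ)

/-- The step tries the images of one of the `r` points, or uses one of the lines. -/
def SearchStep.isValid (r : ℕ) (lines : Fin 3 → List (ℕ × ℕ × ℕ)) : SearchStep → Bool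
  | .guess a => decide (a < r)
  | .line i a b c => thirdPoint (lines i) a b == some c

/-- The point `y` is the image of a point other than `a`. -/
def isTaken (env : List (ℕ × ℕ)) (a y : ℕ) : Bool := env.any fun e => !(e.1 == a) && e.2 == y

/-- All injective partial maps found by the search satisfy `good`. -/
def searchAll (r : ℕ) (lines : Fin 3 → List (ℕ × ℕ × ℕ)) (τ : Fin 3 → Fin 3)
    (good : List (ℕ × ℕ) → Bool) : List SearchStep → List (ℕ × ℕ) → Bool
  | [], env => good env
  | .guess a :: S, env => (List.range r).all fun y =>
      isTaken env a y || searchAll r lines τ good S ((a, y) :: env)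
  | .line i a b c :: S, env =>
    match env.lookup a, env.lookup b with
    | some a', some b' =>
      match thirdPoint (lines (τ i)) a' b' with
      -- No listed line joins the two images, so this branch is contradictory.
      | none => true
      | some z =>
        match env.lookup c with
        | some c' => !(c' == z) || searchAll r lines τ good S env
        | none => isTaken env c z || searchAll r lines τ good S ((c, z) :: env)
    -- A line with an endpoint whose image is still unknown is skipped, which loses information but
    -- stays sound.
    | _, _ => searchAll r lines τ good S env

/-! ### Soundness of the search -/

theorem lookup_sound {σ : ℕ → ℕ} {env : List (ℕ × ℕ)} (h : ∀ e ∈ env, σ e.1 = e.2) {a a' : ℕ}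
    (ha : env.lookup a = some a') : σ a = a' := by
  induction env with
  | nil => simp at ha
  | cons e env ih =>
    rw [List.lookup_cons] at ha
    split at ha
    · rename_i hb
      have := h e List.mem_cons_self
      rw [beq_iff_eq.1 hb, this]
      simpa using ha
    · exact ih (fun e he => h e (List.mem_cons_of_mem _ he)) ha

/-- Injectivity of `σ` ensures that the pruning never discards the true image of a point. -/
theorem isTaken_sound {r : ℕ} {σ : ℕ → ℕ} (hσ : Set.InjOn σ (Set.Iio r)) {env : List (ℕ × ℕ)}
    (h : ∀ e ∈ env, σ e.1 = e.2 ∧ e.1 < r) {a : ℕ} (ha : a < r) : isTaken env a (σ a) = false := by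
  rw [Bool.eq_false_iff]
  intro ht
  simp only [isTaken, List.any_eq_true, Bool.and_eq_true, Bool.not_eq_true', beq_eq_false_iff_ne,
    beq_iff_eq] at ht
  obtain ⟨e, he, hne, heq⟩ := ht
  exact hne (hσ (h e he).2 ha ((h e he).1.trans heq))

/-- The branch in which every guess agrees with `σ` is never cut, so it runs to the end and its
environment records true values of `σ`. -/
theorem searchAll_sound {r : ℕ} {lines : Fin 3 → List (ℕ × ℕ × ℕ)} {τ : Fin 3 → Fin 3}
    {good : List (ℕ × ℕ) → Bool} {σ : ℕ → ℕ} (hσ : Set.InjOn σ (Set.Iio r))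
    (hr : ∀ a < r, σ a < r) :
    ∀ (S : List SearchStep) (env : List (ℕ × ℕ)),
      (∀ s ∈ S, match s with
        | .guess a => a < r
        | .line i a b c => c < r ∧ thirdPoint (lines (τ i)) (σ a) (σ b) = some (σ c)) →
      (∀ e ∈ env, σ e.1 = e.2 ∧ e.1 < r) →
      searchAll r lines τ good S env = true →
      ∃ env' : List (ℕ × ℕ), (∀ e ∈ env', σ e.1 = e.2 ∧ e.1 < r) ∧ good env' = true
  | [], env, _, henv, h => ⟨env, henv, h⟩
  | .guess a :: S, env, hS, henv, h => by
    have hS' := fun s hs => hS s (List.mem_cons_of_mem _ hs)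
    have ha : a < r := hS _ List.mem_cons_self
    rw [searchAll, List.all_eq_true] at h
    have := h (σ a) (List.mem_range.2 (hr a ha))
    rw [isTaken_sound hσ henv ha, Bool.false_or] at this
    refine searchAll_sound hσ hr S _ hS' (fun e he => ?_) this
    rcases List.mem_cons.1 he with rfl | he
    exacts [⟨rfl, ha⟩, henv e he]
  | .line i a b c :: S, env, hS, henv, h => by
    have hS' := fun s hs => hS s (List.mem_cons_of_mem _ hs)
    obtain ⟨hc, hline⟩ : c < r ∧ thirdPoint (lines (τ i)) (σ a) (σ b) = some (σ c) :=
      hS _ List.mem_cons_self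
    have henv1 : ∀ e ∈ env, σ e.1 = e.2 := fun e he => (henv e he).1
    rw [searchAll] at h
    split at h
    · rename_i a' b' ha hb
      rw [← lookup_sound henv1 ha, ← lookup_sound henv1 hb, hline] at h
      simp only at h
      split at h
      · rename_i c' hc'
        rw [lookup_sound henv1 hc'] at h
        simp only [BEq.rfl, Bool.not_true, Bool.false_or] at h
        exact searchAll_sound hσ hr S _ hS' henv h
      · rw [isTaken_sound hσ henv hc, Bool.false_or] at h
        refine searchAll_sound hσ hr S _ hS' (fun e he => ?_) h
        rcases List.mem_cons.1 he with rfl | he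
        exacts [⟨rfl, hc⟩, henv e he]
    · exact searchAll_sound hσ hr S _ hS' henv h

/-- The points that are joined to points of the given list by the lines of `L`. -/
def spread : List (ℕ × ℕ × ℕ) → List ℕ → List ℕ
  | [], known => known
  | (a, b, c) :: L, known =>
    if known.contains a || known.contains b || known.contains c
    then spread L (a :: b :: c :: known) else spread L known

/-- A function constant on each line is constant on all points reached. The lines are used in one
pass, so their order in `L` affects how far the list reaches, but not soundness. -/
theorem spread_sound {α : Type*} {f : ℕ → α} {y : α} :
    ∀ (L : List (ℕ × ℕ × ℕ)) (known : List ℕ),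
      (∀ s ∈ L, f s.1 = f s.2.2 ∧ f s.2.1 = f s.2.2) → (∀ k ∈ known, f k = y) →
      ∀ k ∈ spread L known, f k = y
  | [], _, _, hk => hk
  | (a, b, c) :: L, known, hL, hk => by
    have hL' := fun s hs => hL s (List.mem_cons_of_mem _ hs)
    obtain ⟨h1, h2⟩ := hL (a, b, c) List.mem_cons_self
    simp only at h1 h2
    rw [spread]
    split_ifs with h
    · refine spread_sound L _ hL' fun k hk' => ?_
      simp only [Bool.or_eq_true, List.contains_iff_mem] at h
      have hc : f c = y := by
        rcases h with (h | h) | h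
        · rw [← h1, hk _ h]
        · rw [← h2, hk _ h]
        · exact hk _ h
      simp only [List.mem_cons] at hk'
      rcases hk' with rfl | rfl | rfl | hk'
      exacts [h1.trans hc, h2.trans hc, hc, hk _ hk']
    · exact spread_sound L _ hL' hk

end Search

/-! ### Decompositions given by integer matrices -/

section Scheme

/-- The matrices of the `l`-th tensor of a decomposition with the given tables of integers. -/
def rowMat (K : Type*) [Field K] (d : Fin 3 → ℕ) (rows : Fin 3 → List (List ℤ)) (l : ℕ)
    (i : Fin 3) : MatFactor K d i :=
  flatMat K (d i) (d (i + 1)) ((rows i).getD l [])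

/-- The `l`-th tensor of the decomposition with the given tables of integers. -/
noncomputable def rowTensor (K : Type*) [Field K] (d : Fin 3 → ℕ) (rows : Fin 3 → List (List ℤ))
    (l : ℕ) : ⨂[K] i, MatFactor K d i :=
  PiTensorProduct.tprod K (rowMat K d rows l)

/-- In each factor, no two of the `r` matrices are proportional at the first place, and `lines`
lists the triples of matrices that satisfy a linear relation without zero coefficients, over every
field. -/
structure LineScheme (d : Fin 3 → ℕ) (r : ℕ) (rows : Fin 3 → List (List ℤ))
    (lines : Fin 3 → List (ℕ × ℕ × ℕ)) : Prop where
  length_eq : ∀ i, ∀ l < r, ((rows i).getD l []).length = d i * d (i + 1)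
  exists_unit : ∀ i, ∀ l < r, ∃ a ∈ (rows i).getD l [], a.natAbs = 1
  indep : ∀ a < r, ∀ b < r, a ≠ b → indepPair ((rows 0).getD a []) ((rows 0).getD b []) = true
  line : ∀ i, ∀ s ∈ lines i, s.1 < s.2.1 ∧ s.2.1 < s.2.2 ∧ s.2.2 < r ∧
    indepPair ((rows i).getD s.1 []) ((rows i).getD s.2.1 []) = true ∧
    hasSignRel ((rows i).getD s.1 []) ((rows i).getD s.2.1 []) ((rows i).getD s.2.2 []) = true
  third : ∀ i, ∀ s ∈ lines i,
    thirdPoint (lines i) s.1 s.2.1 = some s.2.2 ∧ thirdPoint (lines i) s.2.1 s.1 = some s.2.2 ∧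
    thirdPoint (lines i) s.1 s.2.2 = some s.2.1 ∧ thirdPoint (lines i) s.2.2 s.1 = some s.2.1 ∧
    thirdPoint (lines i) s.2.1 s.2.2 = some s.1 ∧ thirdPoint (lines i) s.2.2 s.2.1 = some s.1
  noLine : ∀ i, ∀ c < r, ∀ b < c, ∀ a < b, ((lines i).contains (a, b, c) ||
    noLinRel ((rows i).getD a []) ((rows i).getD b []) ((rows i).getD c [])) = true

theorem mem_of_thirdPoint_eq_some {L : List (ℕ × ℕ × ℕ)} {a b c : ℕ}
    (h : thirdPoint L a b = some c) :
    (a, b, c) ∈ L ∨ (b, a, c) ∈ L ∨ (a, c, b) ∈ L ∨ (b, c, a) ∈ L ∨ (c, a, b) ∈ L ∨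
      (c, b, a) ∈ L := by
  induction L with
  | nil => simp [thirdPoint] at h
  | cons s L ih =>
    obtain ⟨x, y, z⟩ := s
    simp only [thirdPoint, Bool.and_eq_true, beq_iff_eq] at h
    rw [List.mem_cons, List.mem_cons, List.mem_cons, List.mem_cons, List.mem_cons, List.mem_cons]
    split_ifs at h with h1 h2 h3 h4 h5 h6
    · obtain ⟨rfl, rfl⟩ := h1
      exact .inl (.inl (by rw [Option.some.inj h]))
    · obtain ⟨rfl, rfl⟩ := h2
      exact .inr (.inl (.inl (by rw [Option.some.inj h])))
    · obtain ⟨rfl, rfl⟩ := h3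
      exact .inr (.inr (.inl (.inl (by rw [Option.some.inj h]))))
    · obtain ⟨rfl, rfl⟩ := h4
      exact .inr (.inr (.inr (.inl (.inl (by rw [Option.some.inj h])))))
    · obtain ⟨rfl, rfl⟩ := h5
      exact .inr (.inr (.inr (.inr (.inl (.inl (by rw [Option.some.inj h]))))))
    · obtain ⟨rfl, rfl⟩ := h6
      exact .inr (.inr (.inr (.inr (.inr (.inl (by rw [Option.some.inj h]))))))
    · exact (ih h).imp .inr (Or.imp .inr (Or.imp .inr (Or.imp .inr (Or.imp .inr .inr))))

variable {K : Type*} [Field K] {d : Fin 3 → ℕ} {r : ℕ} {rows : Fin 3 → List (List ℤ)}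
  {lines : Fin 3 → List (ℕ × ℕ × ℕ)}

namespace LineScheme

theorem rowMat_ne_zero (H : LineScheme d r rows lines) {l : ℕ} (hl : l < r) (i : Fin 3) :
    rowMat K d rows l i ≠ 0 := by
  intro h
  obtain ⟨a, ha, ha1⟩ := H.exists_unit i l hl
  obtain ⟨k, hk, e⟩ := List.mem_iff_getElem.1 ha
  obtain ⟨p, q, hpq⟩ := exists_flat_index (H.length_eq i l hl ▸ hk)
  have := congrFun (congrFun h p) q
  rw [rowMat, flatMat_apply, hpq, List.getD_eq_getElem _ _ hk, e] at this
  exact intCast_ne_zero_of_natAbs_eq_one ha1 this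

/-- Equal tensors would have proportional matrices in the first factor, contrary to `indep`. -/
theorem rowTensor_injOn (H : LineScheme d r rows lines) {a b : ℕ} (ha : a < r) (hb : b < r)
    (h : rowTensor K d rows a = rowTensor K d rows b) : a = b := by
  by_contra hne
  obtain ⟨c, hc, -⟩ := exists_smul_of_tprod_eq (fun i => H.rowMat_ne_zero ha i) h
  have h0 := indepPair_flatMat (K := K) (H.length_eq 0 a ha) (H.indep a ha b hb hne) (c 0) (-1)
    (by
      have h1 : flatMat K (d 0) (d (0 + 1)) ((rows 0).getD b []) =
        c 0 • flatMat K (d 0) (d (0 + 1)) ((rows 0).getD a []) := hc 0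
      rw [h1]
      module)
  exact one_ne_zero (neg_eq_zero.1 h0.2)

theorem linRel_of_mem (H : LineScheme d r rows lines) {i : Fin 3} {a b c : ℕ}
    (h : (a, b, c) ∈ lines i) :
    LinRel K (rowMat K d rows a i) (rowMat K d rows b i) (rowMat K d rows c i) := by
  obtain ⟨h1, h2, h3, -, h5⟩ := H.line i _ h
  exact hasSignRel_sound (H.length_eq i a (h1.trans (h2.trans h3))) h5

theorem of_thirdPoint (H : LineScheme d r rows lines) {i : Fin 3} {a b c : ℕ}
    (h : thirdPoint (lines i) a b = some c) :
    a < r ∧ b < r ∧ c < r ∧ a ≠ b ∧ a ≠ c ∧ b ≠ c ∧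
    LinRel K (rowMat K d rows a i) (rowMat K d rows b i) (rowMat K d rows c i) := by
  rcases mem_of_thirdPoint_eq_some h with h | h | h | h | h | h <;>
    obtain ⟨h1, h2, h3, -⟩ := H.line i _ h <;> simp only at h1 h2 h3 <;>
    have hl := H.linRel_of_mem (K := K) h <;>
    refine ⟨by omega, by omega, by omega, by omega, by omega, by omega, ?_⟩
  · exact hl
  · exact hl.swap_left
  · exact hl.swap_right
  · exact hl.swap_right.swap_left
  · exact hl.swap_left.swap_right
  · exact hl.swap_left.swap_right.swap_left

/-- Completeness of the list over `K`: any triple missing from it carries a certificate against a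
relation. -/
theorem mem_of_linRel (H : LineScheme d r rows lines) {i : Fin 3} {a b c : ℕ} (hab : a < b)
    (hbc : b < c) (hc : c < r)
    (h : LinRel K (rowMat K d rows a i) (rowMat K d rows b i) (rowMat K d rows c i)) :
    (a, b, c) ∈ lines i := by
  have := H.noLine i c hc b hbc a hab
  rw [Bool.or_eq_true, List.contains_iff_mem] at this
  exact this.resolve_right fun h' =>
    noLinRel_sound (H.length_eq i a (hab.trans (hbc.trans hc))) h' h

theorem thirdPoint_of_linRel (H : LineScheme d r rows lines) {i : Fin 3} {a b c : ℕ} (ha : a < r)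
    (hb : b < r) (hc : c < r) (hab : a ≠ b) (hac : a ≠ c) (hbc : b ≠ c)
    (h : LinRel K (rowMat K d rows a i) (rowMat K d rows b i) (rowMat K d rows c i)) :
    thirdPoint (lines i) a b = some c := by
  rcases lt_or_gt_of_ne hab with h1 | h1 <;> rcases lt_or_gt_of_ne hbc with h2 | h2 <;>
    rcases lt_or_gt_of_ne hac with h3 | h3
  · exact (H.third i _ (H.mem_of_linRel h1 h2 hc h)).1
  · omega
  · exact (H.third i _ (H.mem_of_linRel h3 h2 hb h.swap_right)).2.2.1
  · exact (H.third i _ (H.mem_of_linRel h3 h1 hb h.swap_right.swap_left)).2.2.2.2.1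
  · exact (H.third i _ (H.mem_of_linRel h1 h3 hc h.swap_left)).2.1
  · exact (H.third i _ (H.mem_of_linRel h2 h3 ha h.swap_left.swap_right)).2.2.2.1
  · omega
  · exact (H.third i _ (H.mem_of_linRel h2 h1 ha h.swap_left.swap_right.swap_left)).2.2.2.2.2

/-- The data of an automorphism of the decomposition: it permutes the tensors, and its factors map
the matrices accordingly, up to scalars. -/
structure IsAction (d : Fin 3 → ℕ) (r : ℕ) (rows : Fin 3 → List (List ℤ))
    (φ : (⨂[K] i, MatFactor K d i) ≃ₗ[K] (⨂[K] i, MatFactor K d i))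
    (τ : Equiv.Perm (Fin 3)) (f : ∀ i, MatFactor K d i ≃ₗ[K] MatFactor K d (τ i)) (σ : ℕ → ℕ)
    (c : ℕ → Fin 3 → K) : Prop where
  hasDecData : HasDecData φ τ f
  injOn : Set.InjOn σ (Set.Iio r)
  lt : ∀ l < r, σ l < r
  map_tensor : ∀ l < r, φ (rowTensor K d rows l) = rowTensor K d rows (σ l)
  map_mat : ∀ l < r, ∀ i, f i (rowMat K d rows l i) = c l i • rowMat K d rows (σ l) (τ i)
  prod_eq : ∀ l < r, ∏ i, c l i = 1

theorem exists_isAction (H : LineScheme d r rows lines)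
    {φ : (⨂[K] i, MatFactor K d i) ≃ₗ[K] (⨂[K] i, MatFactor K d i)}
    (hφ : φ ∈ autGroup (Set.range fun l : Fin r => rowTensor K d rows l)) :
    ∃ τ f σ c, IsAction d r rows φ τ f σ c := by
  obtain ⟨τ, f, σ, c, h1, h2, h3, h4, h5⟩ := exists_perm_of_mem_autGroup
    (x := fun l : Fin r => rowMat K d rows l) (fun l i => H.rowMat_ne_zero l.2 i)
    (fun a b hab => Fin.ext (H.rowTensor_injOn a.2 b.2 hab)) hφ
  -- Extending `σ` and `c` to all natural numbers allows plain numerals in the search; the values at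
  -- `l ≥ r` play no role.
  refine ⟨τ, f, fun l => if h : l < r then σ ⟨l, h⟩ else l,
    fun l => if h : l < r then c ⟨l, h⟩ else 1, h1, ?_, ?_, ?_, ?_, ?_⟩
  · intro a ha b hb hab
    have ha' : a < r := ha
    have hb' : b < r := hb
    simp only [ha', hb', dif_pos] at hab
    exact congrArg Fin.val (h2 (Fin.ext hab))
  · intro l hl
    simp only [hl, dif_pos, Fin.is_lt]
  · intro l hl
    simp only [hl, dif_pos]
    exact h3 ⟨l, hl⟩
  · intro l hl i
    simp only [hl, dif_pos]
    exact h4 ⟨l, hl⟩ i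
  · intro l hl
    simp only [hl, dif_pos]
    exact h5 ⟨l, hl⟩

variable {φ : (⨂[K] i, MatFactor K d i) ≃ₗ[K] (⨂[K] i, MatFactor K d i)}
  {τ : Equiv.Perm (Fin 3)} {f : ∀ i, MatFactor K d i ≃ₗ[K] MatFactor K d (τ i)} {σ : ℕ → ℕ}
  {c : ℕ → Fin 3 → K}

theorem IsAction.coeff_ne_zero (h : IsAction d r rows φ τ f σ c) {l : ℕ} (hl : l < r)
    (i : Fin 3) : c l i ≠ 0 :=
  Finset.prod_ne_zero_iff.1 (by rw [h.prod_eq l hl]; exact one_ne_zero) i (Finset.mem_univ i)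

/-- A listed line is a linear relation, `f i` transports it to factor `τ i`, and completeness of the
list there makes it a listed line again. This is the passage from linear algebra to combinatorics.
-/
theorem thirdPoint_map (H : LineScheme d r rows lines) (h : IsAction d r rows φ τ f σ c)
    {i : Fin 3} {x y z : ℕ} (hl : thirdPoint (lines i) x y = some z) :
    thirdPoint (lines (τ i)) (σ x) (σ y) = some (σ z) := by
  obtain ⟨hx, hy, hz, hxy, hxz, hyz, hrel⟩ := H.of_thirdPoint (K := K) hl
  exact H.thirdPoint_of_linRel (K := K) (h.lt x hx) (h.lt y hy) (h.lt z hz)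
    (h.injOn.ne hx hy hxy) (h.injOn.ne hx hz hxz) (h.injOn.ne hy hz hyz)
    (hrel.map (h.coeff_ne_zero hx i) (h.coeff_ne_zero hy i) (h.coeff_ne_zero hz i)
      (h.map_mat x hx i) (h.map_mat y hy i) (h.map_mat z hz i))

/-- Neither the search nor its result mentions `K`; one finite computation for each order of the
factors therefore serves all fields. -/
theorem exists_env (H : LineScheme d r rows lines) (h : IsAction d r rows φ τ f σ c)
    {S : List SearchStep}
    (hS : ∀ s ∈ S, s.isValid r lines = true)
    {good : (Fin 3 → Fin 3) → List (ℕ × ℕ) → Bool}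
    (hsearch : ∀ x y z : Fin 3, x ≠ y → x ≠ z → y ≠ z →
      searchAll r lines ![x, y, z] (good ![x, y, z]) S [] = true) :
    ∃ env : List (ℕ × ℕ), (∀ e ∈ env, σ e.1 = e.2) ∧ good τ env = true := by
  have hτ : (τ : Fin 3 → Fin 3) = ![τ 0, τ 1, τ 2] := by
    funext i
    fin_cases i <;> rfl
  have hs := hsearch (τ 0) (τ 1) (τ 2) (τ.injective.ne (by decide)) (τ.injective.ne (by decide))
    (τ.injective.ne (by decide))
  rw [← hτ] at hs
  obtain ⟨env, henv, hgood⟩ := searchAll_sound h.injOn h.lt S [] (fun s hs' => by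
    have := hS s hs'
    cases s with
    | guess a => exact of_decide_eq_true this
    | line i x y z =>
      have := beq_iff_eq.1 this
      exact ⟨(H.of_thirdPoint (K := K) this).2.2.1, H.thirdPoint_map h this⟩)
    (by simp) hs
  exact ⟨env, fun e he => (henv e he).1, hgood⟩

/-- An automorphism that fixes enough of the tensors, and does not permute the factors, is
trivial. The tensor `l₀` is connected by lines to the tensors of the list `spread (lines i) [l₀]`
in the factor `i`. -/
theorem eq_one_of_fixed (H : LineScheme d r rows lines) {l₀ : ℕ} {S : Fin 3 → List (ℕ × ℕ)}
    {rest : List ℕ} (hrest : ∀ l ∈ rest, l < r) (hl₀ : l₀ ∈ rest)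
    (hlines : ∀ i, ∀ s ∈ lines i, s.1 ∈ rest ∧ s.2.1 ∈ rest ∧ s.2.2 ∈ rest)
    (hS : ∀ i, ∀ s ∈ S i, s.1 ∈ rest ∧
      ((s.1 ∈ spread (lines 0) [l₀] ∧ s.1 ∈ spread (lines 1) [l₀]) ∨
        (s.1 ∈ spread (lines 0) [l₀] ∧ s.1 ∈ spread (lines 2) [l₀]) ∨
        (s.1 ∈ spread (lines 1) [l₀] ∧ s.1 ∈ spread (lines 2) [l₀])))
    (hspan : ∀ i, ∀ k < d i * d (i + 1),
      k ∈ triangular ((S i).map fun s => ((rows i).getD s.1 [], s.2)) [])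
    (h : IsAction d r rows φ τ f σ c) (hτ : τ = 1) (hσ : ∀ l ∈ rest, σ l = l) : φ = 1 := by
  subst hτ
  have hmap : ∀ l ∈ rest, ∀ i, f i (rowMat K d rows l i) = c l i • rowMat K d rows l i := by
    intro l hl i
    have := h.map_mat l (hrest l hl) i
    rwa [hσ l hl] at this
  -- Within one factor, eigenvalues agree along connected lines.
  have hconn : ∀ i, ∀ l ∈ spread (lines i) [l₀], c l i = c l₀ i := by
    intro i
    refine spread_sound (f := fun l => c l i) (lines i) [l₀] (fun s hs => ?_) (by simp)
    obtain ⟨h1, h2, h3⟩ := hlines i s hs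
    obtain ⟨h4, h5, h6, h7, -⟩ := H.line i s hs
    exact (H.linRel_of_mem (K := K) hs).eigenvalue_eq (f := f i) (hmap _ h1 i) (hmap _ h2 i)
      (hmap _ h3 i) (indepPair_flatMat (H.length_eq i _ (h4.trans (h5.trans h6))) h7)
  -- Once two of the three eigenvalues agree with those of `l₀`, the third does too, because both
  -- products are `1`.
  have hconst : ∀ l ∈ rest, ((l ∈ spread (lines 0) [l₀] ∧ l ∈ spread (lines 1) [l₀]) ∨
        (l ∈ spread (lines 0) [l₀] ∧ l ∈ spread (lines 2) [l₀]) ∨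
        (l ∈ spread (lines 1) [l₀] ∧ l ∈ spread (lines 2) [l₀])) → ∀ i, c l i = c l₀ i := by
    intro l hl hk
    have e := (h.prod_eq l (hrest l hl)).trans (h.prod_eq l₀ (hrest l₀ hl₀)).symm
    rw [Fin.prod_univ_three, Fin.prod_univ_three] at e
    have n := h.coeff_ne_zero (hrest l₀ hl₀)
    have all : c l 0 = c l₀ 0 ∧ c l 1 = c l₀ 1 ∧ c l 2 = c l₀ 2 := by
      rcases hk with ⟨h1, h2⟩ | ⟨h1, h2⟩ | ⟨h1, h2⟩ <;>
        have h1 := hconn _ _ h1 <;> have h2 := hconn _ _ h2 <;> rw [h1, h2] at e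
      · exact ⟨h1, h2, mul_left_cancel₀ (mul_ne_zero (n 0) (n 1)) e⟩
      · exact ⟨h1, mul_left_cancel₀ (n 0) (mul_right_cancel₀ (n 2) e), h2⟩
      · exact ⟨mul_right_cancel₀ (n 1) (mul_right_cancel₀ (n 2) e), h1, h2⟩
    intro i
    fin_cases i
    exacts [all.1, all.2.1, all.2.2]
  refine eq_one_of_hasDecData_smul (f := f) (C := c l₀) h.hasDecData (fun i => ?_)
    (h.prod_eq l₀ (hrest l₀ hl₀))
  let g : MatFactor K d i ≃ₗ[K] MatFactor K d i := f i
  -- The difference from the scalar map kills matrices from which all matrix units can be obtained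
  -- by elimination.
  have hzero : g.toLinearMap - c l₀ i • LinearMap.id = 0 := by
    refine linearMap_eq_zero_of_triangular _
      (S := (S i).map fun s => ((rows i).getD s.1 [], s.2)) (fun s hs => ?_) (hspan i)
    obtain ⟨s', hs', rfl⟩ := List.mem_map.1 hs
    obtain ⟨h1, h2⟩ := hS i s' hs'
    refine ⟨H.length_eq i _ (hrest _ h1), ?_⟩
    have e := hmap _ h1 i
    rw [hconst _ h1 h2 i] at e
    exact sub_eq_zero.2 e
  intro u
  exact sub_eq_zero.1 (LinearMap.congr_fun hzero u)

end LineScheme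

end Scheme

/-! ### Trilinearity and the matrix multiplication tensor -/

section Tri

variable {K : Type*} [Field K] {m n p : ℕ}

/-- The family with entries `x, y, z`. -/
def triFamily (x : Matrix (Fin m) (Fin n) K) (y : Matrix (Fin n) (Fin p) K)
    (z : Matrix (Fin p) (Fin m) K) : ∀ i, MatFactor K ![m, n, p] i := fun i => match i with
  | 0 => x
  | 1 => y
  | 2 => z

theorem tri_eq_tprod (x : Matrix (Fin m) (Fin n) K) (y : Matrix (Fin n) (Fin p) K)
    (z : Matrix (Fin p) (Fin m) K) :
    tri x y z = PiTensorProduct.tprod K (triFamily x y z) := rfl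

theorem exists_linearMap_tri_left (y : Matrix (Fin n) (Fin p) K) (z : Matrix (Fin p) (Fin m) K) :
    ∃ L : Matrix (Fin m) (Fin n) K →ₗ[K] MMSpace K m n p, ∀ x, L x = tri x y z := by
  refine ⟨(PiTensorProduct.tprod K).toLinearMap (triFamily 0 y z) 0, fun x => ?_⟩
  change PiTensorProduct.tprod K (Function.update (triFamily 0 y z) 0 x) = PiTensorProduct.tprod K _
  congr 1
  funext i
  fin_cases i <;> rfl

theorem exists_linearMap_tri_middle (x : Matrix (Fin m) (Fin n) K)
    (z : Matrix (Fin p) (Fin m) K) :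
    ∃ L : Matrix (Fin n) (Fin p) K →ₗ[K] MMSpace K m n p, ∀ y, L y = tri x y z := by
  refine ⟨(PiTensorProduct.tprod K).toLinearMap (triFamily x 0 z) 1, fun y => ?_⟩
  change PiTensorProduct.tprod K (Function.update (triFamily x 0 z) 1 y) = PiTensorProduct.tprod K _
  congr 1
  funext i
  fin_cases i <;> rfl

theorem exists_linearMap_tri_right (x : Matrix (Fin m) (Fin n) K)
    (y : Matrix (Fin n) (Fin p) K) :
    ∃ L : Matrix (Fin p) (Fin m) K →ₗ[K] MMSpace K m n p, ∀ z, L z = tri x y z := by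
  refine ⟨(PiTensorProduct.tprod K).toLinearMap (triFamily x y 0) 2, fun z => ?_⟩
  change PiTensorProduct.tprod K (Function.update (triFamily x y 0) 2 z) = PiTensorProduct.tprod K _
  congr 1
  funext i
  fin_cases i <;> rfl

theorem tri_smul (a b c : K) (x : Matrix (Fin m) (Fin n) K) (y : Matrix (Fin n) (Fin p) K)
    (z : Matrix (Fin p) (Fin m) K) : tri (a • x) (b • y) (c • z) = (a * b * c) • tri x y z := by
  obtain ⟨L, hL⟩ := exists_linearMap_tri_left (b • y) (c • z)
  obtain ⟨M, hM⟩ := exists_linearMap_tri_middle x (c • z)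
  obtain ⟨N, hN⟩ := exists_linearMap_tri_right x y
  rw [← hL, map_smul, hL, ← hM, map_smul, hM, ← hN, map_smul, hN, smul_smul, smul_smul]

theorem linearMap_eq_sum_single {V : Type*} [AddCommGroup V] [Module K V]
    (L : Matrix (Fin m) (Fin n) K →ₗ[K] V) (x : Matrix (Fin m) (Fin n) K) :
    L x = ∑ i, ∑ j, x i j • L (Matrix.single i j 1) := by
  conv_lhs => rw [Matrix.matrix_eq_sum_single x]
  simp only [map_sum]
  refine Finset.sum_congr rfl fun i _ => Finset.sum_congr rfl fun j _ => ?_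
  rw [← map_smul, Matrix.smul_single, smul_eq_mul, mul_one]

theorem tri_eq_sum (x : Matrix (Fin m) (Fin n) K) (y : Matrix (Fin n) (Fin p) K)
    (z : Matrix (Fin p) (Fin m) K) :
    tri x y z = ∑ i, ∑ j, ∑ j', ∑ k, ∑ k', ∑ i', (x i j * y j' k * z k' i') •
      tri (Matrix.single i j 1) (Matrix.single j' k 1) (Matrix.single k' i' 1) := by
  obtain ⟨L, hL⟩ := exists_linearMap_tri_left y z
  rw [← hL, linearMap_eq_sum_single]
  refine Finset.sum_congr rfl fun i _ => Finset.sum_congr rfl fun j _ => ?_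
  obtain ⟨M, hM⟩ := exists_linearMap_tri_middle (Matrix.single i j 1) z
  rw [hL, ← hM, linearMap_eq_sum_single, Finset.smul_sum]
  refine Finset.sum_congr rfl fun j' _ => ?_
  rw [Finset.smul_sum]
  refine Finset.sum_congr rfl fun k _ => ?_
  obtain ⟨N, hN⟩ := exists_linearMap_tri_right (Matrix.single i j 1) (Matrix.single j' k (1 : K))
  rw [hM, ← hN, linearMap_eq_sum_single, smul_smul, Finset.smul_sum]
  refine Finset.sum_congr rfl fun k' _ => ?_
  rw [Finset.smul_sum]
  refine Finset.sum_congr rfl fun i' _ => ?_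
  rw [hN, smul_smul]

/-- The six-fold sum with indicator coefficients has the shape of `tri_eq_sum`, so that the two can
be compared term by term. -/
theorem matMulTensor_eq_sum : matMulTensor K m n p =
    ∑ i : Fin m, ∑ j : Fin n, ∑ j' : Fin n, ∑ k : Fin p, ∑ k' : Fin p, ∑ i' : Fin m,
      (if j = j' ∧ k = k' ∧ i = i' then (1 : K) else 0) •
      tri (Matrix.single i j 1) (Matrix.single j' k 1) (Matrix.single k' i' 1) := by
  rw [matMulTensor]
  refine Finset.sum_congr rfl fun i _ => Finset.sum_congr rfl fun j _ => ?_
  simp [ite_and, ite_smul]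

theorem rowTensor_eq_tri (rows : Fin 3 → List (List ℤ)) (l : ℕ) :
    (rowTensor K ![m, n, p] rows l : MMSpace K m n p) =
      tri (flatMat K m n ((rows 0).getD l [])) (flatMat K n p ((rows 1).getD l []))
        (flatMat K p m ((rows 2).getD l [])) := by
  rw [rowTensor, tri_eq_tprod]
  congr 1
  funext i
  fin_cases i <;> rfl

/-- The hypothesis is the system of Brent equations, one for each product of three matrix units.
Solved over the integers, they hold over every field. -/
theorem sum_rowTensor_eq_matMulTensor {rows : Fin 3 → List (List ℤ)} {r : ℕ}
    (h : ∀ i < m, ∀ j < n, ∀ j' < n, ∀ k < p, ∀ k' < p, ∀ i' < m,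
      ((List.range r).map fun l => ((rows 0).getD l []).getD (j + n * i) 0 *
        ((rows 1).getD l []).getD (k + p * j') 0 * ((rows 2).getD l []).getD (i' + m * k') 0).sum =
      if j = j' ∧ k = k' ∧ i = i' then (1 : ℤ) else 0) :
    ∑ l : Fin r, (rowTensor K ![m, n, p] rows l : MMSpace K m n p) = matMulTensor K m n p := by
  simp_rw [rowTensor_eq_tri]
  rw [matMulTensor_eq_sum, Finset.sum_congr rfl fun l _ => tri_eq_sum _ _ _, Finset.sum_comm]
  refine Finset.sum_congr rfl fun i _ => ?_
  rw [Finset.sum_comm]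
  refine Finset.sum_congr rfl fun j _ => ?_
  rw [Finset.sum_comm]
  refine Finset.sum_congr rfl fun j' _ => ?_
  rw [Finset.sum_comm]
  refine Finset.sum_congr rfl fun k _ => ?_
  rw [Finset.sum_comm]
  refine Finset.sum_congr rfl fun k' _ => ?_
  rw [Finset.sum_comm]
  refine Finset.sum_congr rfl fun i' _ => ?_
  rw [← Finset.sum_smul]
  congr 1
  have := congrArg (Int.cast : ℤ → K) (h i i.2 j j.2 j' j'.2 k k.2 k' k'.2 i' i'.2)
  rw [← List.sum_toFinset _ List.nodup_range, List.toFinset_range, Finset.sum_range] at this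
  push_cast at this
  simpa [flatMat_apply, Fin.ext_iff] using this

end Tri

/-! ### Existence of decomposable automorphisms -/

section Existence

variable {K : Type*} [Field K] {m n p : ℕ}

theorem exists_mem_decAut_tri (e₀ : Matrix (Fin m) (Fin n) K ≃ₗ[K] Matrix (Fin m) (Fin n) K)
    (e₁ : Matrix (Fin n) (Fin p) K ≃ₗ[K] Matrix (Fin n) (Fin p) K)
    (e₂ : Matrix (Fin p) (Fin m) K ≃ₗ[K] Matrix (Fin p) (Fin m) K) :
    ∃ Φ ∈ decAut K (MatFactor K ![m, n, p]),
      ∀ x y z, Φ (tri x y z : MMSpace K m n p) = tri (e₀ x) (e₁ y) (e₂ z) := by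
  let f : ∀ i, MatFactor K ![m, n, p] i ≃ₗ[K] MatFactor K ![m, n, p] ((1 : Equiv.Perm (Fin 3)) i) :=
    fun i => match i with
    | 0 => e₀
    | 1 => e₁
    | 2 => e₂
  obtain ⟨Φ, hΦ⟩ := exists_hasDecData 1 f
  refine ⟨Φ, ⟨_, f, hΦ⟩, fun x y z => hΦ _ _ fun i => ?_⟩
  fin_cases i <;> rfl

theorem exists_mem_decAut_tri_swap
    (e₀ : Matrix (Fin n) (Fin m) K ≃ₗ[K] Matrix (Fin m) (Fin n) K)
    (e₁ : Matrix (Fin m) (Fin n) K ≃ₗ[K] Matrix (Fin n) (Fin m) K)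
    (e₂ : Matrix (Fin m) (Fin m) K ≃ₗ[K] Matrix (Fin m) (Fin m) K) :
    ∃ Φ ∈ decAut K (MatFactor K ![m, n, m]),
      ∀ x y z, Φ (tri x y z : MMSpace K m n m) = tri (e₀ y) (e₁ x) (e₂ z) := by
  -- The map at place `0` lands in place `1`, so it has to be `e₁`, and conversely.
  let τ : Equiv.Perm (Fin 3) := ⟨![1, 0, 2], ![1, 0, 2], by decide, by decide⟩
  let f : ∀ i, MatFactor K ![m, n, m] i ≃ₗ[K] MatFactor K ![m, n, m] (τ i) :=
    fun i => match i with
    | 0 => e₁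
    | 1 => e₀
    | 2 => e₂
  obtain ⟨Φ, hΦ⟩ := exists_hasDecData τ f
  refine ⟨Φ, ⟨_, f, hΦ⟩, fun x y z => hΦ _ _ fun i => ?_⟩
  fin_cases i <;> rfl

theorem exists_mem_decAut_tri_cycle
    (e₀ e₁ e₂ : Matrix (Fin n) (Fin n) K ≃ₗ[K] Matrix (Fin n) (Fin n) K) :
    ∃ Φ ∈ decAut K (MatFactor K ![n, n, n]),
      ∀ x y z, Φ (tri x y z : MMSpace K n n n) = tri (e₀ z) (e₁ x) (e₂ y) := by
  let τ : Equiv.Perm (Fin 3) := ⟨![1, 2, 0], ![2, 0, 1], by decide, by decide⟩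
  let f : ∀ i, MatFactor K ![n, n, n] i ≃ₗ[K] MatFactor K ![n, n, n] (τ i) :=
    fun i => match i with
    | 0 => e₁
    | 1 => e₂
    | 2 => e₀
  obtain ⟨Φ, hΦ⟩ := exists_hasDecData τ f
  refine ⟨Φ, ⟨_, f, hΦ⟩, fun x y z => hΦ _ _ fun i => ?_⟩
  fin_cases i <;> rfl

theorem exists_sandwich {a a' : Matrix (Fin m) (Fin m) K} {b b' : Matrix (Fin n) (Fin n) K}
    (ha : a * a' = 1) (hb : b * b' = 1) :
    ∃ e : Matrix (Fin m) (Fin n) K ≃ₗ[K] Matrix (Fin m) (Fin n) K, ∀ x, e x = a * x * b := by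
  have ha' := mul_eq_one_comm.1 ha
  have hb' := mul_eq_one_comm.1 hb
  refine ⟨{ toFun := fun x => a * x * b
            invFun := fun x => a' * x * b'
            map_add' := fun x y => by rw [Matrix.mul_add, Matrix.add_mul]
            map_smul' := fun c x => by simp
            left_inv := fun x => ?_
            right_inv := fun x => ?_ }, fun x => rfl⟩
  · simp only [← Matrix.mul_assoc, ha', Matrix.one_mul]
    rw [Matrix.mul_assoc, hb, Matrix.mul_one]
  · simp only [← Matrix.mul_assoc, ha, Matrix.one_mul]
    rw [Matrix.mul_assoc, hb', Matrix.mul_one]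

theorem exists_sandwich_transpose {a a' : Matrix (Fin n) (Fin n) K}
    {b b' : Matrix (Fin m) (Fin m) K} (ha : a * a' = 1) (hb : b * b' = 1) :
    ∃ e : Matrix (Fin m) (Fin n) K ≃ₗ[K] Matrix (Fin n) (Fin m) K, ∀ x, e x = a * xᵀ * b := by
  obtain ⟨e, he⟩ := exists_sandwich ha hb
  exact ⟨(Matrix.transposeLinearEquiv (Fin m) (Fin n) K K).trans e, fun x => he xᵀ⟩

/-- An injective map of a finite set into itself is onto. -/
theorem mem_autGroup_of_forall_mem {ι : Type*} {V : ι → Type*} [∀ i, AddCommGroup (V i)]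
    [∀ i, Module K (V i)] {A : Set (⨂[K] i, V i)} (hA : A.Finite)
    {Φ : (⨂[K] i, V i) ≃ₗ[K] (⨂[K] i, V i)} (hΦ : Φ ∈ decAut K V) (h : ∀ t ∈ A, Φ t ∈ A) :
    Φ ∈ autGroup A :=
  ⟨hΦ, Set.eq_of_subset_of_ncard_le (Set.image_subset_iff.2 h)
    (Set.ncard_image_of_injective A Φ.injective).ge hA⟩

end Existence

/-! ### Transport of integer identities -/

section IntMatrix

variable {K : Type*} [Field K] {m n p q : ℕ}

theorem flatMat_eq_map (u : List ℤ) :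
    flatMat K m n u = (flatMat ℤ m n u).map (Int.castRingHom K) := rfl

theorem flatMat_mul {u v w : List ℤ} (h : flatMat ℤ m n u * flatMat ℤ n p v = flatMat ℤ m p w) :
    flatMat K m n u * flatMat K n p v = flatMat K m p w := by
  rw [flatMat_eq_map, flatMat_eq_map, ← Matrix.map_mul, h, flatMat_eq_map]

theorem flatMat_sandwich {a b u v : List ℤ} {s : ℤ}
    (h : flatMat ℤ m n a * flatMat ℤ n p u * flatMat ℤ p q b = s • flatMat ℤ m q v) :
    flatMat K m n a * flatMat K n p u * flatMat K p q b = (s : K) • flatMat K m q v := by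
  rw [flatMat_eq_map, flatMat_eq_map, flatMat_eq_map, ← Matrix.map_mul, ← Matrix.map_mul, h,
    flatMat_eq_map]
  ext i j
  simp

theorem flatMat_sandwich_transpose {a b u v : List ℤ} {s : ℤ}
    (h : flatMat ℤ m n a * (flatMat ℤ p n u)ᵀ * flatMat ℤ p q b = s • flatMat ℤ m q v) :
    flatMat K m n a * (flatMat K p n u)ᵀ * flatMat K p q b = (s : K) • flatMat K m q v := by
  rw [flatMat_eq_map, flatMat_eq_map, flatMat_eq_map, ← Matrix.transpose_map, ← Matrix.map_mul,
    ← Matrix.map_mul, h, flatMat_eq_map]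
  ext i j
  simp

/-- The signs `s`, `t` and `s * t` multiply to `1`. -/
theorem tri_eq_of_signs {x x' : Matrix (Fin m) (Fin n) K} {y y' : Matrix (Fin n) (Fin p) K}
    {z z' : Matrix (Fin p) (Fin m) K} {s t : ℤ} (hs : s ∈ [1, -1]) (ht : t ∈ [1, -1])
    (hx : x = (s : K) • x') (hy : y = (t : K) • y') (hz : z = ((s * t : ℤ) : K) • z') :
    tri x y z = tri x' y' z' := by
  rw [hx, hy, hz, tri_smul]
  simp only [List.mem_cons, List.not_mem_nil, or_false] at hs ht
  rcases hs with rfl | rfl <;> rcases ht with rfl | rfl <;> simp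

theorem flatMat_three_two (a b c d e f : ℤ) :
    flatMat K 3 2 [a, b, c, d, e, f] = !![(a : K), b; c, d; e, f] := by
  ext i j
  fin_cases i <;> fin_cases j <;> rfl

theorem flatMat_two_three (a b c d e f : ℤ) :
    flatMat K 2 3 [a, b, c, d, e, f] = !![(a : K), b, c; d, e, f] := by
  ext i j
  fin_cases i <;> fin_cases j <;> rfl

theorem flatMat_three_three (a b c d e f g h i : ℤ) :
    flatMat K 3 3 [a, b, c, d, e, f, g, h, i] = !![(a : K), b, c; d, e, f; g, h, i] := by
  ext i j
  fin_cases i <;> fin_cases j <;> rfl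

theorem flatMat_two_two (a b c d : ℤ) : flatMat K 2 2 [a, b, c, d] = !![(a : K), b; c, d] := by
  ext i j
  fin_cases i <;> fin_cases j <;> rfl

theorem flatMat_mul_eq_one {u v : List ℤ} (h : flatMat ℤ m m u * flatMat ℤ m m v = 1) :
    flatMat K m m u * flatMat K m m v = 1 := by
  rw [flatMat_eq_map, flatMat_eq_map, ← Matrix.map_mul, h]
  exact Matrix.map_one _ (map_zero _) (map_one _)

end IntMatrix

/-! ### Automorphisms of decompositions given by integer matrices -/

section Generators

variable {m n p r : ℕ} {rows : Fin 3 → List (List ℤ)} {σ : ℕ → ℕ}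
  {a₀ a₀' b₀ b₀' a₁ a₁' b₁ b₁' a₂ a₂' b₂ b₂' : List ℤ}

/-- All hypotheses are integer identities, so the kernel can decide them once for all fields. The
primed lists are inverses, making each sandwich map invertible; each image matches a row only up to
signs, with the third sign forced by the other two. -/
theorem exists_straight_automorphism (K : Type*) [Field K]
    (ha₀ : flatMat ℤ m m a₀ * flatMat ℤ m m a₀' = 1)
    (hb₀ : flatMat ℤ n n b₀ * flatMat ℤ n n b₀' = 1)
    (ha₁ : flatMat ℤ n n a₁ * flatMat ℤ n n a₁' = 1)
    (hb₁ : flatMat ℤ p p b₁ * flatMat ℤ p p b₁' = 1)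
    (ha₂ : flatMat ℤ p p a₂ * flatMat ℤ p p a₂' = 1)
    (hb₂ : flatMat ℤ m m b₂ * flatMat ℤ m m b₂' = 1)
    (hσ : ∀ l < r, ∃ s ∈ [(1 : ℤ), -1], ∃ t ∈ [(1 : ℤ), -1],
      flatMat ℤ m m a₀ * flatMat ℤ m n ((rows 0).getD l []) * flatMat ℤ n n b₀ =
        s • flatMat ℤ m n ((rows 0).getD (σ l) []) ∧
      flatMat ℤ n n a₁ * flatMat ℤ n p ((rows 1).getD l []) * flatMat ℤ p p b₁ =
        t • flatMat ℤ n p ((rows 1).getD (σ l) []) ∧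
      flatMat ℤ p p a₂ * flatMat ℤ p m ((rows 2).getD l []) * flatMat ℤ m m b₂ =
        (s * t) • flatMat ℤ p m ((rows 2).getD (σ l) [])) :
    ∃ Φ ∈ decAut K (MatFactor K ![m, n, p]),
      (∀ x y z, Φ (tri x y z : MMSpace K m n p) =
        tri (flatMat K m m a₀ * x * flatMat K n n b₀) (flatMat K n n a₁ * y * flatMat K p p b₁)
          (flatMat K p p a₂ * z * flatMat K m m b₂)) ∧
      ∀ l < r, Φ (rowTensor K ![m, n, p] rows l) = rowTensor K ![m, n, p] rows (σ l) := by
  obtain ⟨e₀, he₀⟩ := exists_sandwich (flatMat_mul_eq_one (K := K) ha₀)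
    (flatMat_mul_eq_one (K := K) hb₀)
  obtain ⟨e₁, he₁⟩ := exists_sandwich (flatMat_mul_eq_one (K := K) ha₁)
    (flatMat_mul_eq_one (K := K) hb₁)
  obtain ⟨e₂, he₂⟩ := exists_sandwich (flatMat_mul_eq_one (K := K) ha₂)
    (flatMat_mul_eq_one (K := K) hb₂)
  obtain ⟨Φ, hΦ, h⟩ := exists_mem_decAut_tri e₀ e₁ e₂
  simp only [he₀, he₁, he₂] at h
  refine ⟨Φ, hΦ, h, fun l hl => ?_⟩
  obtain ⟨s, hs, t, ht, h0, h1, h2⟩ := hσ l hl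
  rw [rowTensor_eq_tri, rowTensor_eq_tri]
  exact (h _ _ _).trans (tri_eq_of_signs hs ht (flatMat_sandwich h0) (flatMat_sandwich h1)
    (flatMat_sandwich h2))

theorem exists_swap_automorphism (K : Type*) [Field K]
    (ha₀ : flatMat ℤ m m a₀ * flatMat ℤ m m a₀' = 1)
    (hb₀ : flatMat ℤ n n b₀ * flatMat ℤ n n b₀' = 1)
    (ha₁ : flatMat ℤ n n a₁ * flatMat ℤ n n a₁' = 1)
    (hb₁ : flatMat ℤ m m b₁ * flatMat ℤ m m b₁' = 1)
    (ha₂ : flatMat ℤ m m a₂ * flatMat ℤ m m a₂' = 1)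
    (hb₂ : flatMat ℤ m m b₂ * flatMat ℤ m m b₂' = 1)
    (hσ : ∀ l < r, ∃ s ∈ [(1 : ℤ), -1], ∃ t ∈ [(1 : ℤ), -1],
      flatMat ℤ m m a₀ * (flatMat ℤ n m ((rows 1).getD l []))ᵀ * flatMat ℤ n n b₀ =
        s • flatMat ℤ m n ((rows 0).getD (σ l) []) ∧
      flatMat ℤ n n a₁ * (flatMat ℤ m n ((rows 0).getD l []))ᵀ * flatMat ℤ m m b₁ =
        t • flatMat ℤ n m ((rows 1).getD (σ l) []) ∧
      flatMat ℤ m m a₂ * (flatMat ℤ m m ((rows 2).getD l []))ᵀ * flatMat ℤ m m b₂ =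
        (s * t) • flatMat ℤ m m ((rows 2).getD (σ l) [])) :
    ∃ Φ ∈ decAut K (MatFactor K ![m, n, m]),
      (∀ x y z, Φ (tri x y z : MMSpace K m n m) =
        tri (flatMat K m m a₀ * yᵀ * flatMat K n n b₀) (flatMat K n n a₁ * xᵀ * flatMat K m m b₁)
          (flatMat K m m a₂ * zᵀ * flatMat K m m b₂)) ∧
      ∀ l < r, Φ (rowTensor K ![m, n, m] rows l) = rowTensor K ![m, n, m] rows (σ l) := by
  obtain ⟨e₀, he₀⟩ := exists_sandwich_transpose (flatMat_mul_eq_one (K := K) ha₀)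
    (flatMat_mul_eq_one (K := K) hb₀)
  obtain ⟨e₁, he₁⟩ := exists_sandwich_transpose (flatMat_mul_eq_one (K := K) ha₁)
    (flatMat_mul_eq_one (K := K) hb₁)
  obtain ⟨e₂, he₂⟩ := exists_sandwich_transpose (flatMat_mul_eq_one (K := K) ha₂)
    (flatMat_mul_eq_one (K := K) hb₂)
  obtain ⟨Φ, hΦ, h⟩ := exists_mem_decAut_tri_swap e₀ e₁ e₂
  simp only [he₀, he₁, he₂] at h
  refine ⟨Φ, hΦ, h, fun l hl => ?_⟩
  obtain ⟨s, hs, t, ht, h0, h1, h2⟩ := hσ l hl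
  rw [rowTensor_eq_tri, rowTensor_eq_tri]
  exact (h _ _ _).trans (tri_eq_of_signs hs ht (flatMat_sandwich_transpose h0)
    (flatMat_sandwich_transpose h1) (flatMat_sandwich_transpose h2))

theorem exists_cycle_automorphism (K : Type*) [Field K]
    (ha₀ : flatMat ℤ n n a₀ * flatMat ℤ n n a₀' = 1)
    (hb₀ : flatMat ℤ n n b₀ * flatMat ℤ n n b₀' = 1)
    (ha₁ : flatMat ℤ n n a₁ * flatMat ℤ n n a₁' = 1)
    (hb₁ : flatMat ℤ n n b₁ * flatMat ℤ n n b₁' = 1)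
    (ha₂ : flatMat ℤ n n a₂ * flatMat ℤ n n a₂' = 1)
    (hb₂ : flatMat ℤ n n b₂ * flatMat ℤ n n b₂' = 1)
    (hσ : ∀ l < r, ∃ s ∈ [(1 : ℤ), -1], ∃ t ∈ [(1 : ℤ), -1],
      flatMat ℤ n n a₀ * flatMat ℤ n n ((rows 2).getD l []) * flatMat ℤ n n b₀ =
        s • flatMat ℤ n n ((rows 0).getD (σ l) []) ∧
      flatMat ℤ n n a₁ * flatMat ℤ n n ((rows 0).getD l []) * flatMat ℤ n n b₁ =
        t • flatMat ℤ n n ((rows 1).getD (σ l) []) ∧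
      flatMat ℤ n n a₂ * flatMat ℤ n n ((rows 1).getD l []) * flatMat ℤ n n b₂ =
        (s * t) • flatMat ℤ n n ((rows 2).getD (σ l) [])) :
    ∃ Φ ∈ decAut K (MatFactor K ![n, n, n]),
      (∀ x y z, Φ (tri x y z : MMSpace K n n n) =
        tri (flatMat K n n a₀ * z * flatMat K n n b₀) (flatMat K n n a₁ * x * flatMat K n n b₁)
          (flatMat K n n a₂ * y * flatMat K n n b₂)) ∧
      ∀ l < r, Φ (rowTensor K ![n, n, n] rows l) = rowTensor K ![n, n, n] rows (σ l) := by
  obtain ⟨e₀, he₀⟩ := exists_sandwich (flatMat_mul_eq_one (K := K) ha₀)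
    (flatMat_mul_eq_one (K := K) hb₀)
  obtain ⟨e₁, he₁⟩ := exists_sandwich (flatMat_mul_eq_one (K := K) ha₁)
    (flatMat_mul_eq_one (K := K) hb₁)
  obtain ⟨e₂, he₂⟩ := exists_sandwich (flatMat_mul_eq_one (K := K) ha₂)
    (flatMat_mul_eq_one (K := K) hb₂)
  obtain ⟨Φ, hΦ, h⟩ := exists_mem_decAut_tri_cycle e₀ e₁ e₂
  simp only [he₀, he₁, he₂] at h
  refine ⟨Φ, hΦ, h, fun l hl => ?_⟩
  obtain ⟨s, hs, t, ht, h0, h1, h2⟩ := hσ l hl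
  rw [rowTensor_eq_tri, rowTensor_eq_tri]
  exact (h _ _ _).trans (tri_eq_of_signs hs ht (flatMat_sandwich h0) (flatMat_sandwich h1)
    (flatMat_sandwich h2))

theorem mem_autGroup_of_map_rowTensor {K : Type*} [Field K] {d : Fin 3 → ℕ}
    {Φ : (⨂[K] i, MatFactor K d i) ≃ₗ[K] (⨂[K] i, MatFactor K d i)}
    (hΦ : Φ ∈ decAut K (MatFactor K d)) (hr : ∀ l < r, σ l < r)
    (h : ∀ l < r, Φ (rowTensor K d rows l) = rowTensor K d rows (σ l)) :
    Φ ∈ autGroup (Set.range fun l : Fin r => rowTensor K d rows l) := by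
  refine mem_autGroup_of_forall_mem (Set.finite_range _) hΦ ?_
  rintro _ ⟨l, rfl⟩
  exact ⟨⟨σ l, hr l l.2⟩, (h l l.2).symm⟩

end Generators

/-! ### The matrices of the generators as integer lists -/

section Special

variable (K : Type*) [Field K]

theorem flatMat_identity_three : flatMat K 3 3 [1, 0, 0, 0, 1, 0, 0, 0, 1] = 1 := by
  rw [flatMat_three_three, Matrix.one_fin_three]
  simp

theorem pi12_eq_flatMat : pi12 K = flatMat K 3 3 [0, 1, 0, 1, 0, 0, 0, 0, 1] := by
  simp [pi12, flatMat_three_three]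

theorem pi13_eq_flatMat : pi13 K = flatMat K 3 3 [0, 0, 1, 0, 1, 0, 1, 0, 0] := by
  simp [pi13, flatMat_three_three]

theorem pi23_eq_flatMat : pi23 K = flatMat K 3 3 [1, 0, 0, 0, 0, 1, 0, 1, 0] := by
  simp [pi23, flatMat_three_three]

theorem pi123_eq_flatMat : pi123 K = flatMat K 3 3 [0, 0, 1, 1, 0, 0, 0, 1, 0] := by
  simp [pi123, flatMat_three_three]

theorem pi123_inv_eq_flatMat : (pi123 K)⁻¹ = flatMat K 3 3 [0, 1, 0, 0, 0, 1, 1, 0, 0] := by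
  rw [pi123_eq_flatMat]
  exact Matrix.inv_eq_right_inv (flatMat_mul_eq_one (by decide +kernel))

theorem eps1_eq_flatMat : eps1 K = flatMat K 3 3 [-1, 0, 0, 0, 1, 0, 0, 0, 1] := by
  rw [eps1, flatMat_three_three]
  ext i j
  fin_cases i <;> fin_cases j <;> simp

theorem eps2_eq_flatMat : eps2 K = flatMat K 3 3 [1, 0, 0, 0, -1, 0, 0, 0, 1] := by
  rw [eps2, flatMat_three_three]
  ext i j
  fin_cases i <;> fin_cases j <;> simp

theorem sq12_eq_flatMat : sq12 K = flatMat K 2 2 [0, 1, 1, 0] := by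
  simp [sq12, flatMat_two_two]

theorem sqEps1_eq_flatMat : sqEps1 K = flatMat K 2 2 [-1, 0, 0, 1] := by
  rw [sqEps1, flatMat_two_two]
  ext i j
  fin_cases i <;> fin_cases j <;> simp

theorem sqD_eq_flatMat : sqD K = flatMat K 2 2 [0, -1, 1, -1] := by
  simp [sqD, flatMat_two_two]

theorem sqD_inv_eq_flatMat : (sqD K)⁻¹ = flatMat K 2 2 [-1, 1, -1, 0] := by
  rw [sqD_eq_flatMat]
  exact Matrix.inv_eq_right_inv (flatMat_mul_eq_one (by decide +kernel))

end Special

/-! ### The Hopcroft algorithm -/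

/-- The entries of the matrices of the Hopcroft algorithm. -/
def hopcroftRows : Fin 3 → List (List ℤ)
  | 0 => [
    [1, -1, 0, 0, 0, 0], [0, 1, 0, 0, 0, 0], [0, 0, 1, 0, 0, 0], [0, 0, 0, 1, 0, 0],
    [0, 0, 0, 0, 1, 0], [0, 0, 0, 0, -1, 1], [1, 0, 1, 0, 0, 0], [1, -1, 1, 0, 0, 0],
    [1, -1, 1, -1, 0, 0], [0, 0, 0, 1, 0, 1], [0, 0, 0, 1, -1, 1], [0, 0, -1, 1, -1, 1],
    [0, 1, 0, 0, 1, 0], [0, 1, 0, 0, 0, 1], [1, 0, 0, 0, 1, 0]]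
  | 1 => [
    [1, 0, 0, 0, 0, 0], [1, 0, 0, 1, 0, 0], [0, 1, 0, 0, 0, 0], [0, 0, 0, 0, 1, 0],
    [0, 0, 1, 0, 0, 1], [0, 0, 0, 0, 0, 1], [1, 1, 0, 1, 1, 0], [1, 0, 0, 1, 1, 0],
    [0, 0, 0, 1, 1, 0], [0, 1, 1, 0, 1, 1], [0, 1, 1, 0, 0, 1], [0, 1, 1, 0, 0, 0],
    [1, 0, 0, 0, 0, -1], [0, 0, 0, 1, 0, 1], [1, 0, 1, 0, 0, 0]]
  | 2 => [
    [1, -1, 0, 0, 0, 0, -1, 0, 0], [1, 0, -1, -1, 0, 0, 0, 0, 0], [0, 0, 0, -1, 1, 0, 0, -1, 0],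
    [0, -1, 0, 0, 1, -1, 0, 0, 0], [0, 0, 0, 0, 0, -1, -1, 0, 1], [0, 0, -1, 0, 0, 0, 0, -1, 1],
    [0, 0, 0, 1, 0, 0, 0, 0, 0], [0, 1, 0, -1, 0, 0, 0, 0, 0], [0, -1, 0, 0, 0, 0, 0, 0, 0],
    [0, 0, 0, 0, 0, 1, 0, 0, 0], [0, 0, 0, 0, 0, -1, 0, 1, 0], [0, 0, 0, 0, 0, 0, 0, -1, 0],
    [0, 0, 1, 0, 0, 0, -1, 0, 0], [0, 0, 1, 0, 0, 0, 0, 0, 0], [0, 0, 0, 0, 0, 0, 1, 0, 0]]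

/-- The triples of linearly dependent matrices in the factors of the Hopcroft algorithm. -/
def hopcroftLines : Fin 3 → List (ℕ × ℕ × ℕ)
  | 0 => [
    (0, 2, 7), (0, 12, 14), (1, 4, 12), (1, 6, 7), (2, 10, 11), (3, 5, 10), (3, 7, 8),
    (4, 9, 10), (5, 12, 13)]
  | 1 => [
    (2, 4, 10), (2, 6, 7), (3, 9, 10), (4, 12, 14), (5, 10, 11), (0, 5, 12), (0, 7, 8),
    (1, 3, 7), (1, 12, 13)]
  | 2 => [
    (6, 7, 8), (9, 10, 11), (12, 13, 14)]

/-- A search that determines the automorphisms of the lines of the Hopcroft algorithm. -/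
def hopcroftSteps : List SearchStep := [
    .guess 0, .guess 5, .line 1 0 5 12, .line 0 0 12 14, .line 0 5 12 13, .line 2 12 13 14,
    .line 1 12 13 1, .line 0 1 12 4, .line 1 4 12 14, .guess 2, .line 0 0 2 7, .line 0 1 7 6,
    .line 1 2 6 7, .line 1 0 7 8, .line 2 6 7 8, .line 0 7 8 3, .line 1 1 3 7, .line 0 3 5 10,
    .line 1 2 4 10, .line 0 2 10 11, .line 1 5 10 11, .line 0 4 10 9, .line 1 3 9 10,
    .line 2 9 10 11]

/-- Matrices of the Hopcroft algorithm, with the matrix units obtained from them one by one. -/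
def hopcroftSpan : Fin 3 → List (ℕ × ℕ)
  | 0 => [
    (1, 1), (2, 2), (3, 3), (4, 4), (5, 5), (6, 0)]
  | 1 => [
    (0, 0), (1, 3), (2, 1), (3, 4), (5, 5), (9, 2)]
  | 2 => [
    (6, 3), (7, 1), (9, 5), (10, 7), (13, 2), (14, 6), (0, 0), (2, 4), (4, 8)]

/-- A finite check on integers, including all triples of matrices in each factor; it fixes the line
structure independently of the field. -/
theorem hopcroft_scheme : LineScheme ![3, 2, 3] 15 hopcroftRows hopcroftLines where
  length_eq := by decide +kernel
  exists_unit := by decide +kernel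
  indep := by decide +kernel
  line := by decide +kernel
  third := by decide +kernel
  noLine := by decide +kernel

theorem hopcroft_eq_rowTensor (K : Type*) [Field K] :
    hopcroft K = fun l : Fin 15 => rowTensor K ![3, 2, 3] hopcroftRows l := by
  funext l
  rw [rowTensor_eq_tri]
  fin_cases l <;>
    simp [hopcroft, hopcroftRows, flatMat_three_two, flatMat_two_three, flatMat_three_three]

theorem isAlgorithm_hopcroft (K : Type*) [Field K] :
    IsAlgorithm (hopcroft K) (matMulTensor K 3 2 3) := by
  rw [hopcroft_eq_rowTensor]
  exact ⟨fun l => ⟨_, rfl⟩, fun a b h => Fin.ext (hopcroft_scheme.rowTensor_injOn a.2 b.2 h),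
    sum_rowTensor_eq_matMulTensor (by decide +kernel)⟩

/-- Six of the tensors of the Hopcroft algorithm, on which its automorphisms act as on the
vertices of a triangular prism. -/
def prismVertex (w : Fin 3 × ZMod 2) : ℕ :=
  (([[0, 1], [3, 2], [4, 5]] : List (List ℕ)).getD w.1 []).getD w.2.val 0

/-- The action of `S₃ × Z₂` on the vertices of a triangular prism. -/
def prismAction : Equiv.Perm (Fin 3) × Multiplicative (ZMod 2) →* Equiv.Perm (Fin 3 × ZMod 2) :=
  MonoidHom.mk' (fun p => Equiv.prodCongr p.1 (Equiv.addLeft p.2.toAdd)) fun p q =>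
    Equiv.ext fun w => Prod.ext rfl (by simp [add_assoc])

theorem prismAction_apply (p : Equiv.Perm (Fin 3) × Multiplicative (ZMod 2))
    (w : Fin 3 × ZMod 2) : prismAction p w = (p.1 w.1, p.2.toAdd + w.2) := rfl

theorem prismAction_injective : Function.Injective prismAction := by
  rw [injective_iff_map_eq_one]
  intro p hp
  have h : ∀ w, (p.1 w.1, p.2.toAdd + w.2) = w := fun w => by
    rw [← prismAction_apply, hp, Equiv.Perm.one_apply]
  refine Prod.ext (Equiv.ext fun j => congrArg Prod.fst (h (j, 0))) ?_
  have := congrArg Prod.snd (h (0, 0))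
  exact Multiplicative.toAdd.injective (by simpa using this)

theorem prismVertex_injective : Function.Injective prismVertex := by decide +kernel

theorem prismVertex_lt (w : Fin 3 × ZMod 2) : prismVertex w < 15 := by
  revert w
  decide +kernel

/-- The partial map `env` is induced by a symmetry of the prism, and if it fixes the vertices of
the prism, then it fixes everything, and `τ` is trivial. -/
def hopcroftGood (τ : Fin 3 → Fin 3) (env : List (ℕ × ℕ)) : Bool :=
  decide (∃ k₀ : ZMod 2, ∀ j : Fin 3, ∃ j' : Fin 3, ∀ k : ZMod 2,
    (prismVertex (j, k), prismVertex (j', k₀ + k)) ∈ env) &&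
  (decide (∃ w : Fin 3 × ZMod 2, ∃ e ∈ env, e.1 = prismVertex w ∧ e.2 ≠ prismVertex w) ||
    decide ((∀ i, τ i = i) ∧ ∀ l ∈ List.range 15, (l, l) ∈ env))

theorem hopcroft_search : ∀ x y z : Fin 3, x ≠ y → x ≠ z → y ≠ z →
    searchAll 15 hopcroftLines ![x, y, z] (hopcroftGood ![x, y, z]) hopcroftSteps [] = true := by
  decide +kernel

theorem hopcroftSteps_valid : ∀ s ∈ hopcroftSteps, s.isValid 15 hopcroftLines = true := by
  decide +kernel

section

variable {K : Type*} [Field K] {Φ : MMSpace K 3 2 3 ≃ₗ[K] MMSpace K 3 2 3}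

/-- The search yields one common shift `k₀` of the second coordinate and images `g j` of the first;
injectivity of `σ` makes `g` a permutation. -/
theorem hopcroft_action (hΦ : Φ ∈ autGroup (Set.range (hopcroft K))) :
    ∃ p, ∀ w, Φ (rowTensor K ![3, 2, 3] hopcroftRows (prismVertex w)) =
      rowTensor K ![3, 2, 3] hopcroftRows (prismVertex (prismAction p w)) := by
  rw [hopcroft_eq_rowTensor] at hΦ
  obtain ⟨τ, f, σ, c, h⟩ := hopcroft_scheme.exists_isAction hΦ
  obtain ⟨env, henv, hgood⟩ := hopcroft_scheme.exists_env h hopcroftSteps_valid hopcroft_search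
  rw [hopcroftGood, Bool.and_eq_true, decide_eq_true_iff] at hgood
  obtain ⟨⟨k₀, hk⟩, -⟩ := hgood
  choose g hg using hk
  have hσ : ∀ j k, σ (prismVertex (j, k)) = prismVertex (g j, k₀ + k) :=
    fun j k => henv _ (hg j k)
  have hinj : Function.Injective g := by
    intro a b hab
    have e := (hσ a 0).trans ((congrArg (fun j => prismVertex (j, k₀ + 0)) hab).trans
      (hσ b 0).symm)
    exact congrArg Prod.fst (prismVertex_injective
      (h.injOn (prismVertex_lt _) (prismVertex_lt _) e))
  refine ⟨(Equiv.ofBijective g (Finite.injective_iff_bijective.1 hinj), Multiplicative.ofAdd k₀),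
    fun w => ?_⟩
  rw [h.map_tensor _ (prismVertex_lt w)]
  exact congrArg _ (hσ w.1 w.2)

theorem hopcroft_eq_one (hΦ : Φ ∈ autGroup (Set.range (hopcroft K)))
    (hfix : ∀ w, Φ (rowTensor K ![3, 2, 3] hopcroftRows (prismVertex w)) =
      rowTensor K ![3, 2, 3] hopcroftRows (prismVertex w)) : Φ = 1 := by
  rw [hopcroft_eq_rowTensor] at hΦ
  obtain ⟨τ, f, σ, c, h⟩ := hopcroft_scheme.exists_isAction hΦ
  obtain ⟨env, henv, hgood⟩ := hopcroft_scheme.exists_env h hopcroftSteps_valid hopcroft_search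
  rw [hopcroftGood, Bool.and_eq_true, Bool.or_eq_true, decide_eq_true_iff, decide_eq_true_iff,
    decide_eq_true_iff] at hgood
  rcases hgood.2 with ⟨w, e, he, h1, h2⟩ | ⟨hτ, hσ⟩
  -- A prism vertex that is moved contradicts `hfix`, since the tensors are distinct.
  · refine absurd (hopcroft_scheme.rowTensor_injOn (K := K) (h.lt _ (prismVertex_lt w))
      (prismVertex_lt w) ((h.map_tensor _ (prismVertex_lt w)).symm.trans (hfix w))) ?_
    rwa [← h1, henv e he, h1]
  -- No line of the third factor passes through the base tensor `2`. Eigenvalues are spread through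
  -- the first two factors, and those of the third come from the product.
  · exact hopcroft_scheme.eq_one_of_fixed (l₀ := 2) (S := hopcroftSpan) (rest := List.range 15)
      (by decide +kernel) (by decide +kernel) (by decide +kernel) (by decide +kernel)
      (by decide +kernel) h (Equiv.ext hτ) fun l hl => henv _ (hσ l hl)

end

/-! ### Generators of the prism group and the Hopcroft automorphisms -/

theorem eq_top_of_adjacent_swap_mem {n : ℕ} {G : Subgroup (Equiv.Perm (Fin (n + 1)))}
    (h : ∀ i : Fin n, Equiv.swap i.castSucc i.succ ∈ G) : G = ⊤ := by
  refine eq_top_iff.2 fun g _ => ?_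
  have hg : g ∈ Submonoid.closure (Set.range fun i : Fin n => Equiv.swap i.castSucc i.succ) := by
    rw [Equiv.Perm.mclosure_swap_castSucc_succ n]
    trivial
  refine (Submonoid.closure_le (S := G.toSubmonoid)).2 ?_ hg
  rintro _ ⟨i, rfl⟩
  exact h i

/-- The symmetries of the prism that come from the generators of the automorphism group of the
Hopcroft algorithm. -/
def prismGenerators : Set (Equiv.Perm (Fin 3) × Multiplicative (ZMod 2)) :=
  {(Equiv.swap 0 1 * Equiv.swap 1 2, 1), (Equiv.swap 0 2, Multiplicative.ofAdd 1),
    (1, Multiplicative.ofAdd 1)}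

theorem closure_prismGenerators : Subgroup.closure prismGenerators = ⊤ := by
  have h1 : (Equiv.swap 0 1 * Equiv.swap 1 2, 1) ∈ Subgroup.closure prismGenerators :=
    Subgroup.subset_closure (by simp [prismGenerators])
  have h2 : (Equiv.swap 0 2, Multiplicative.ofAdd 1) ∈ Subgroup.closure prismGenerators :=
    Subgroup.subset_closure (by simp [prismGenerators])
  have h3 : (1, Multiplicative.ofAdd 1) ∈ Subgroup.closure prismGenerators :=
    Subgroup.subset_closure (by simp [prismGenerators])
  -- Multiplying by the flip leaves the transposition `(0 2)` alone; its products with the 3-cycle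
  -- on the two sides are the adjacent transpositions.
  have h4 := mul_mem h2 h3
  have h5 := mul_mem h1 h4
  have h6 := mul_mem h4 h1
  have hfst : (Subgroup.closure prismGenerators).comap
      (MonoidHom.inl (Equiv.Perm (Fin 3)) (Multiplicative (ZMod 2))) = ⊤ := by
    refine eq_top_of_adjacent_swap_mem (n := 2) (Fin.forall_fin_two.2 ⟨?_, ?_⟩)
    · have e : ((Equiv.swap 0 2, Multiplicative.ofAdd 1) * (1, Multiplicative.ofAdd 1)) *
          (Equiv.swap 0 1 * Equiv.swap 1 2, 1) =
          ((Equiv.swap 0 1, 1) : Equiv.Perm (Fin 3) × Multiplicative (ZMod 2)) := by decide +kernel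
      rw [e] at h6
      exact h6
    · have e : (Equiv.swap 0 1 * Equiv.swap 1 2, 1) *
          ((Equiv.swap 0 2, Multiplicative.ofAdd 1) * (1, Multiplicative.ofAdd 1)) =
          ((Equiv.swap 1 2, 1) : Equiv.Perm (Fin 3) × Multiplicative (ZMod 2)) := by decide +kernel
      rw [e] at h5
      exact h5
  rw [eq_top_iff]
  rintro ⟨p, z⟩ -
  have hp : (p, 1) ∈ Subgroup.closure prismGenerators := by
    have : p ∈ (Subgroup.closure prismGenerators).comap
      (MonoidHom.inl (Equiv.Perm (Fin 3)) (Multiplicative (ZMod 2))) := hfst ▸ trivial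
    exact this
  have hz : (1, z) ∈ Subgroup.closure prismGenerators := by
    have : ∀ z : Multiplicative (ZMod 2), z = 1 ∨ z = Multiplicative.ofAdd 1 := by decide
    rcases this z with rfl | rfl
    exacts [one_mem _, h3]
  have := mul_mem hp hz
  rwa [Prod.mk_mul_mk, mul_one, one_mul] at this

theorem hopcroft_automorphisms (K : Type*) [Field K] :
    (∃ Φ₁ Φ₂ Φ₃ : MMSpace K 3 2 3 ≃ₗ[K] MMSpace K 3 2 3,
      (∀ x y z, Φ₁ (tri x y z) =
        tri (pi123 K * x * (sqD K)⁻¹) (sqD K * y * (pi123 K)⁻¹)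
          (pi123 K * z * (pi123 K)⁻¹)) ∧
      (∀ x y z, Φ₂ (tri x y z) =
        tri (pi13 K * x * sq12 K) (sq12 K * y * pi13 K) (pi13 K * z * pi13 K)) ∧
      (∀ x y z, Φ₃ (tri x y z) =
        tri (yᵀ * sq12 K * sqEps1 K) (sqEps1 K * sq12 K * xᵀ) zᵀ) ∧
      autGroup (Set.range (hopcroft K)) = Subgroup.closure {Φ₁, Φ₂, Φ₃}) ∧
    Nonempty (autGroup (Set.range (hopcroft K)) ≃*
      Equiv.Perm (Fin 3) × Multiplicative (ZMod 2)) := by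
  -- `b₀` is `d⁻¹` and `a₁` is `d`; the other unprimed lists are `π₁₂₃` on the left and its inverse
  -- on the right. The table `σ` is the induced permutation of the tensors, counted from `0`.
  obtain ⟨Φ₁, hΦ₁, h₁, m₁⟩ := exists_straight_automorphism (m := 3) (n := 2) (p := 3) (r := 15)
    (rows := hopcroftRows)
    (σ := fun l => [3, 2, 5, 4, 0, 1, 11, 10, 9, 14, 12, 13, 7, 6, 8].getD l 0)
    (a₀ := [0, 0, 1, 1, 0, 0, 0, 1, 0]) (a₀' := [0, 1, 0, 0, 0, 1, 1, 0, 0])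
    (b₀ := [-1, 1, -1, 0]) (b₀' := [0, -1, 1, -1])
    (a₁ := [0, -1, 1, -1]) (a₁' := [-1, 1, -1, 0])
    (b₁ := [0, 1, 0, 0, 0, 1, 1, 0, 0]) (b₁' := [0, 0, 1, 1, 0, 0, 0, 1, 0])
    (a₂ := [0, 0, 1, 1, 0, 0, 0, 1, 0]) (a₂' := [0, 1, 0, 0, 0, 1, 1, 0, 0])
    (b₂ := [0, 1, 0, 0, 0, 1, 1, 0, 0]) (b₂' := [0, 0, 1, 1, 0, 0, 0, 1, 0]) K
    (by decide +kernel) (by decide +kernel) (by decide +kernel) (by decide +kernel)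
    (by decide +kernel) (by decide +kernel) (by decide +kernel)
  obtain ⟨Φ₂, hΦ₂, h₂, m₂⟩ := exists_straight_automorphism (m := 3) (n := 2) (p := 3) (r := 15)
    (rows := hopcroftRows)
    (σ := fun l => [5, 4, 3, 2, 1, 0, 9, 10, 11, 6, 7, 8, 12, 14, 13].getD l 0)
    (a₀ := [0, 0, 1, 0, 1, 0, 1, 0, 0]) (a₀' := [0, 0, 1, 0, 1, 0, 1, 0, 0])
    (b₀ := [0, 1, 1, 0]) (b₀' := [0, 1, 1, 0]) (a₁ := [0, 1, 1, 0]) (a₁' := [0, 1, 1, 0])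
    (b₁ := [0, 0, 1, 0, 1, 0, 1, 0, 0]) (b₁' := [0, 0, 1, 0, 1, 0, 1, 0, 0])
    (a₂ := [0, 0, 1, 0, 1, 0, 1, 0, 0]) (a₂' := [0, 0, 1, 0, 1, 0, 1, 0, 0])
    (b₂ := [0, 0, 1, 0, 1, 0, 1, 0, 0]) (b₂' := [0, 0, 1, 0, 1, 0, 1, 0, 0]) K
    (by decide +kernel) (by decide +kernel) (by decide +kernel) (by decide +kernel)
    (by decide +kernel) (by decide +kernel) (by decide +kernel)
  -- `b₀` is the product `π'ε'` and `a₁` is `ε'π'`; the identity lists stand for absent factors.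
  obtain ⟨Φ₃, hΦ₃, h₃, m₃⟩ := exists_swap_automorphism (m := 3) (n := 2) (r := 15)
    (rows := hopcroftRows)
    (σ := fun l => [1, 0, 3, 2, 5, 4, 8, 7, 6, 11, 10, 9, 12, 14, 13].getD l 0)
    (a₀ := [1, 0, 0, 0, 1, 0, 0, 0, 1]) (a₀' := [1, 0, 0, 0, 1, 0, 0, 0, 1])
    (b₀ := [0, 1, -1, 0]) (b₀' := [0, -1, 1, 0]) (a₁ := [0, -1, 1, 0]) (a₁' := [0, 1, -1, 0])
    (b₁ := [1, 0, 0, 0, 1, 0, 0, 0, 1]) (b₁' := [1, 0, 0, 0, 1, 0, 0, 0, 1])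
    (a₂ := [1, 0, 0, 0, 1, 0, 0, 0, 1]) (a₂' := [1, 0, 0, 0, 1, 0, 0, 0, 1])
    (b₂ := [1, 0, 0, 0, 1, 0, 0, 0, 1]) (b₂' := [1, 0, 0, 0, 1, 0, 0, 0, 1]) K
    (by decide +kernel) (by decide +kernel) (by decide +kernel) (by decide +kernel)
    (by decide +kernel) (by decide +kernel) (by decide +kernel)
  obtain ⟨hclosure, hiso⟩ := closure_eq_and_nonempty_mulEquiv
    (A := autGroup (Set.range (hopcroft K))) (act := prismAction) (S := {Φ₁, Φ₂, Φ₃})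
    (t := fun w => rowTensor K ![3, 2, 3] hopcroftRows (prismVertex w))
    (fun v w h => prismVertex_injective
      (hopcroft_scheme.rowTensor_injOn (prismVertex_lt v) (prismVertex_lt w) h))
    prismAction_injective (fun φ hφ => hopcroft_action hφ)
    (fun φ hφ hfix => hopcroft_eq_one hφ hfix)
    (by
      rw [hopcroft_eq_rowTensor]
      rintro φ (rfl | rfl | rfl)
      · exact mem_autGroup_of_map_rowTensor hΦ₁ (by decide +kernel) m₁
      · exact mem_autGroup_of_map_rowTensor hΦ₂ (by decide +kernel) m₂
      · exact mem_autGroup_of_map_rowTensor hΦ₃ (by decide +kernel) m₃)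
    closure_prismGenerators
    (by
      rintro q (rfl | rfl | rfl)
      · refine ⟨Φ₁, by simp, fun w => (m₁ _ (prismVertex_lt w)).trans (congrArg _ ?_)⟩
        revert w
        decide +kernel
      · refine ⟨Φ₂, by simp, fun w => (m₂ _ (prismVertex_lt w)).trans (congrArg _ ?_)⟩
        revert w
        decide +kernel
      · refine ⟨Φ₃, by simp, fun w => (m₃ _ (prismVertex_lt w)).trans (congrArg _ ?_)⟩
        revert w
        decide +kernel)
  refine ⟨⟨Φ₁, Φ₂, Φ₃, fun x y z => ?_, fun x y z => ?_, fun x y z => ?_, hclosure⟩, hiso⟩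
  · rw [h₁, pi123_inv_eq_flatMat, sqD_inv_eq_flatMat, pi123_eq_flatMat, sqD_eq_flatMat]
  · rw [h₂, pi13_eq_flatMat, sq12_eq_flatMat]
  · have e : flatMat K 2 2 [0, 1, 1, 0] * flatMat K 2 2 [-1, 0, 0, 1] =
        flatMat K 2 2 [0, 1, -1, 0] := flatMat_mul (by decide +kernel)
    have e' : flatMat K 2 2 [-1, 0, 0, 1] * flatMat K 2 2 [0, 1, 1, 0] =
        flatMat K 2 2 [0, -1, 1, 0] := flatMat_mul (by decide +kernel)
    rw [h₃, sq12_eq_flatMat, sqEps1_eq_flatMat, Matrix.mul_assoc yᵀ, e, e', flatMat_identity_three]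
    simp only [Matrix.one_mul, Matrix.mul_one]

/-! ### The Laderman algorithm -/

/-- The entries of the matrices of the Laderman algorithm. -/
def ladermanRows : Fin 3 → List (List ℤ)
  | 0 => [
    [1, 1, 1, -1, -1, 0, 0, -1, -1], [1, 0, 0, -1, 0, 0, 0, 0, 0], [0, 0, 0, 0, 1, 0, 0, 0, 0],
    [-1, 0, 0, 1, 1, 0, 0, 0, 0], [0, 0, 0, 1, 1, 0, 0, 0, 0], [1, 0, 0, 0, 0, 0, 0, 0, 0],
    [-1, 0, 0, 0, 0, 0, 1, 1, 0], [-1, 0, 0, 0, 0, 0, 1, 0, 0], [0, 0, 0, 0, 0, 0, 1, 1, 0],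
    [1, 1, 1, 0, -1, -1, -1, -1, 0], [0, 0, 0, 0, 0, 0, 0, 1, 0], [0, 0, -1, 0, 0, 0, 0, 1, 1],
    [0, 0, 1, 0, 0, 0, 0, 0, -1], [0, 0, 1, 0, 0, 0, 0, 0, 0], [0, 0, 0, 0, 0, 0, 0, 1, 1],
    [0, 0, -1, 0, 1, 1, 0, 0, 0], [0, 0, 1, 0, 0, -1, 0, 0, 0], [0, 0, 0, 0, 1, 1, 0, 0, 0],
    [0, 1, 0, 0, 0, 0, 0, 0, 0], [0, 0, 0, 0, 0, 1, 0, 0, 0], [0, 0, 0, 1, 0, 0, 0, 0, 0],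
    [0, 0, 0, 0, 0, 0, 1, 0, 0], [0, 0, 0, 0, 0, 0, 0, 0, 1]]
  | 1 => [
    [0, 0, 0, 0, 1, 0, 0, 0, 0], [0, -1, 0, 0, 1, 0, 0, 0, 0], [-1, 1, 0, 1, -1, -1, -1, 0, 1],
    [1, -1, 0, 0, 1, 0, 0, 0, 0], [-1, 1, 0, 0, 0, 0, 0, 0, 0], [1, 0, 0, 0, 0, 0, 0, 0, 0],
    [1, 0, -1, 0, 0, 1, 0, 0, 0], [0, 0, 1, 0, 0, -1, 0, 0, 0], [-1, 0, 1, 0, 0, 0, 0, 0, 0],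
    [0, 0, 0, 0, 0, 1, 0, 0, 0], [-1, 0, 1, 1, -1, -1, -1, 1, 0], [0, 0, 0, 0, 1, 0, 1, -1, 0],
    [0, 0, 0, 0, 1, 0, 0, -1, 0], [0, 0, 0, 0, 0, 0, 1, 0, 0], [0, 0, 0, 0, 0, 0, -1, 1, 0],
    [0, 0, 0, 0, 0, 1, 1, 0, -1], [0, 0, 0, 0, 0, 1, 0, 0, -1], [0, 0, 0, 0, 0, 0, -1, 0, 1],
    [0, 0, 0, 1, 0, 0, 0, 0, 0], [0, 0, 0, 0, 0, 0, 0, 1, 0], [0, 0, 1, 0, 0, 0, 0, 0, 0],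
    [0, 1, 0, 0, 0, 0, 0, 0, 0], [0, 0, 0, 0, 0, 0, 0, 0, 1]]
  | 2 => [
    [0, 0, 0, 1, 0, 0, 0, 0, 0], [0, 1, 0, 0, 1, 0, 0, 0, 0], [0, 1, 0, 0, 0, 0, 0, 0, 0],
    [0, 1, 0, 1, 1, 0, 0, 0, 0], [0, 0, 0, 1, 1, 0, 0, 0, 0], [1, 1, 1, 1, 1, 0, 1, 0, 1],
    [0, 0, 1, 0, 0, 0, 1, 0, 1], [0, 0, 1, 0, 0, 0, 0, 0, 1], [0, 0, 0, 0, 0, 0, 1, 0, 1],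
    [0, 0, 0, 0, 0, 0, 1, 0, 0], [0, 0, 1, 0, 0, 0, 0, 0, 0], [0, 0, 1, 1, 0, 1, 0, 0, 0],
    [0, 0, 1, 0, 0, 1, 0, 0, 0], [1, 1, 1, 1, 0, 1, 1, 1, 0], [0, 0, 0, 1, 0, 1, 0, 0, 0],
    [0, 1, 0, 0, 0, 0, 1, 1, 0], [0, 1, 0, 0, 0, 0, 0, 1, 0], [0, 0, 0, 0, 0, 0, 1, 1, 0],
    [1, 0, 0, 0, 0, 0, 0, 0, 0], [0, 0, 0, 0, 1, 0, 0, 0, 0], [0, 0, 0, 0, 0, 0, 0, 1, 0],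
    [0, 0, 0, 0, 0, 1, 0, 0, 0], [0, 0, 0, 0, 0, 0, 0, 0, 1]]

/-- The triples of linearly dependent matrices in the factors of the Laderman algorithm. -/
def ladermanLines : Fin 3 → List (ℕ × ℕ × ℕ)
  | 0 => [
    (1, 2, 3), (1, 5, 20), (2, 4, 20), (2, 15, 16), (2, 17, 19), (3, 4, 5), (5, 6, 8),
    (5, 7, 21), (6, 7, 10), (8, 10, 21), (10, 11, 12), (10, 14, 22), (11, 13, 14),
    (12, 13, 22), (13, 15, 17), (13, 16, 19)]
  | 1 => [
    (0, 3, 4), (0, 11, 14), (0, 12, 19), (1, 3, 5), (4, 5, 21), (5, 6, 7), (5, 8, 20),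
    (6, 8, 9), (7, 9, 20), (9, 15, 17), (9, 16, 22), (11, 12, 13), (13, 14, 19), (13, 15, 16),
    (13, 17, 22), (0, 1, 21)]
  | 2 => [
    (0, 1, 3), (0, 4, 19), (0, 11, 12), (0, 14, 21), (1, 2, 19), (2, 3, 4), (2, 15, 17),
    (2, 16, 20), (9, 15, 16), (9, 17, 20), (10, 11, 14), (10, 12, 21), (6, 7, 9), (6, 8, 10),
    (7, 10, 22), (8, 9, 22)]

/-- A search that determines the automorphisms of the lines of the Laderman algorithm. -/
def ladermanSteps : List SearchStep := [
    .guess 0, .guess 1, .line 1 0 1 21, .line 2 0 1 3, .line 0 1 3 2, .line 1 0 3 4,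
    .line 2 2 3 4, .line 0 2 4 20, .line 0 1 20 5, .line 0 3 4 5, .line 1 1 3 5,
    .line 1 4 5 21, .line 0 5 21 7, .line 1 5 7 6, .line 0 5 6 8, .line 1 5 8 20,
    .line 0 6 7 10, .line 0 8 10 21, .line 2 6 8 10, .line 1 6 8 9, .line 1 7 9 20,
    .line 2 6 7 9, .line 2 0 4 19, .line 2 1 2 19, .line 0 2 19 17, .line 2 9 17 20,
    .line 1 0 19 12, .line 2 10 12 21, .line 0 10 12 11, .line 2 0 11 12, .line 1 0 11 14,
    .line 2 0 14 21, .line 2 10 11 14, .line 0 10 14 22, .line 2 7 10 22, .line 2 8 9 22,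
    .line 0 11 14 13, .line 0 12 13 22, .line 1 11 12 13, .line 1 13 14 19, .line 1 13 17 22,
    .line 0 13 17 15, .line 1 9 15 17, .line 2 2 15 17, .line 0 2 15 16, .line 0 13 16 19,
    .line 1 9 16 22, .line 1 13 15 16, .line 2 2 16 20, .line 2 9 15 16]

/-- Matrices of the Laderman algorithm, with the matrix units obtained from them one by one. -/
def ladermanSpan : Fin 3 → List (ℕ × ℕ)
  | 0 => [
    (2, 4), (4, 3), (5, 0), (7, 6), (8, 7), (13, 2), (14, 8), (15, 5), (0, 1)]
  | 1 => [
    (0, 4), (1, 1), (3, 0), (8, 2), (9, 5), (12, 7), (13, 6), (15, 8), (2, 3)]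
  | 2 => [
    (0, 3), (2, 1), (3, 4), (9, 6), (10, 2), (11, 5), (15, 7), (22, 8), (5, 0)]

theorem laderman_scheme : LineScheme ![3, 3, 3] 23 ladermanRows ladermanLines where
  length_eq := by decide +kernel
  exists_unit := by decide +kernel
  indep := by decide +kernel
  line := by decide +kernel
  third := by decide +kernel
  noLine := by decide +kernel

theorem laderman_eq_rowTensor (K : Type*) [Field K] :
    laderman K = fun l : Fin 23 => rowTensor K ![3, 3, 3] ladermanRows l := by
  funext l
  rw [rowTensor_eq_tri]
  fin_cases l <;> simp [laderman, ladermanRows, flatMat_three_three]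

theorem isAlgorithm_laderman (K : Type*) [Field K] :
    IsAlgorithm (laderman K) (matMulTensor K 3 3 3) := by
  rw [laderman_eq_rowTensor]
  exact ⟨fun l => ⟨_, rfl⟩, fun a b h => Fin.ext (laderman_scheme.rowTensor_injOn a.2 b.2 h),
    sum_rowTensor_eq_matMulTensor (by decide +kernel)⟩

/-- Four of the tensors of the Laderman algorithm, which its automorphisms permute. -/
def ladermanVertex (w : Fin 4) : ℕ := 19 + w

theorem ladermanVertex_injective : Function.Injective ladermanVertex := by decide +kernel

theorem ladermanVertex_lt (w : Fin 4) : ladermanVertex w < 23 := by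
  revert w
  decide +kernel

/-- The partial map `env` permutes the four vertices, and if it fixes the vertices, then it fixes
everything except possibly the tensor number `18`, and `τ` is trivial. -/
def ladermanGood (τ : Fin 3 → Fin 3) (env : List (ℕ × ℕ)) : Bool :=
  decide (∀ w : Fin 4, ∃ w' : Fin 4, (ladermanVertex w, ladermanVertex w') ∈ env) &&
  (decide (∃ w : Fin 4, ∃ e ∈ env, e.1 = ladermanVertex w ∧ e.2 ≠ ladermanVertex w) ||
    decide ((∀ i, τ i = i) ∧ ∀ l ∈ (List.range 23).erase 18, (l, l) ∈ env))

theorem laderman_search : ∀ x y z : Fin 3, x ≠ y → x ≠ z → y ≠ z →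
    searchAll 23 ladermanLines ![x, y, z] (ladermanGood ![x, y, z]) ladermanSteps [] = true := by
  decide +kernel

theorem ladermanSteps_valid : ∀ s ∈ ladermanSteps, s.isValid 23 ladermanLines = true := by
  decide +kernel

section

variable {K : Type*} [Field K] {Φ : MMSpace K 3 3 3 ≃ₗ[K] MMSpace K 3 3 3}

theorem laderman_action (hΦ : Φ ∈ autGroup (Set.range (laderman K))) :
    ∃ p : Equiv.Perm (Fin 4), ∀ w, Φ (rowTensor K ![3, 3, 3] ladermanRows (ladermanVertex w)) =
      rowTensor K ![3, 3, 3] ladermanRows (ladermanVertex (p w)) := by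
  rw [laderman_eq_rowTensor] at hΦ
  obtain ⟨τ, f, σ, c, h⟩ := laderman_scheme.exists_isAction hΦ
  obtain ⟨env, henv, hgood⟩ := laderman_scheme.exists_env h ladermanSteps_valid laderman_search
  rw [ladermanGood, Bool.and_eq_true, decide_eq_true_iff] at hgood
  choose g hg using hgood.1
  have hσ : ∀ w, σ (ladermanVertex w) = ladermanVertex (g w) := fun w => henv _ (hg w)
  have hinj : Function.Injective g := by
    intro a b hab
    have e := (hσ a).trans ((congrArg ladermanVertex hab).trans (hσ b).symm)
    exact ladermanVertex_injective (h.injOn (ladermanVertex_lt _) (ladermanVertex_lt _) e)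
  refine ⟨Equiv.ofBijective g (Finite.injective_iff_bijective.1 hinj), fun w => ?_⟩
  rw [h.map_tensor _ (ladermanVertex_lt w)]
  exact congrArg _ (hσ w)

/-- The tensor number `18`, which is `e₁₂ ⊗ e₂₁ ⊗ e₁₁`, lies on no line, so the search does not
reach it. It is not needed, because the others already span each factor. -/
theorem laderman_eq_one (hΦ : Φ ∈ autGroup (Set.range (laderman K)))
    (hfix : ∀ w, Φ (rowTensor K ![3, 3, 3] ladermanRows (ladermanVertex w)) =
      rowTensor K ![3, 3, 3] ladermanRows (ladermanVertex w)) : Φ = 1 := by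
  rw [laderman_eq_rowTensor] at hΦ
  obtain ⟨τ, f, σ, c, h⟩ := laderman_scheme.exists_isAction hΦ
  obtain ⟨env, henv, hgood⟩ := laderman_scheme.exists_env h ladermanSteps_valid laderman_search
  rw [ladermanGood, Bool.and_eq_true, Bool.or_eq_true, decide_eq_true_iff, decide_eq_true_iff,
    decide_eq_true_iff] at hgood
  rcases hgood.2 with ⟨w, e, he, h1, h2⟩ | ⟨hτ, hσ⟩
  · refine absurd (laderman_scheme.rowTensor_injOn (K := K) (h.lt _ (ladermanVertex_lt w))
      (ladermanVertex_lt w) ((h.map_tensor _ (ladermanVertex_lt w)).symm.trans (hfix w))) ?_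
    rwa [← h1, henv e he, h1]
  · exact laderman_scheme.eq_one_of_fixed (l₀ := 3) (S := ladermanSpan)
      (rest := (List.range 23).erase 18)
      (by decide +kernel) (by decide +kernel) (by decide +kernel) (by decide +kernel)
      (by decide +kernel) h (Equiv.ext hτ) fun l hl => henv _ (hσ l hl)

end

/-- The permutations of the four vertices that come from the generators of the automorphism group
of the Laderman algorithm. -/
def ladermanGenerators : Set (Equiv.Perm (Fin 4)) :=
  {Equiv.swap 0 2 * Equiv.swap 1 3, Equiv.swap 0 3 * Equiv.swap 1 2, Equiv.swap 1 2,
    Equiv.swap 0 1 * Equiv.swap 1 2}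

theorem closure_ladermanGenerators : Subgroup.closure ladermanGenerators = ⊤ := by
  have h2 : Equiv.swap 0 3 * Equiv.swap 1 2 ∈ Subgroup.closure ladermanGenerators :=
    Subgroup.subset_closure (by simp [ladermanGenerators])
  have h3 : Equiv.swap 1 2 ∈ Subgroup.closure ladermanGenerators :=
    Subgroup.subset_closure (by simp [ladermanGenerators])
  have h4 : Equiv.swap 0 1 * Equiv.swap 1 2 ∈ Subgroup.closure ladermanGenerators :=
    Subgroup.subset_closure (by simp [ladermanGenerators])
  have h5 := mul_mem h4 h3
  have e5 : Equiv.swap 0 1 * Equiv.swap 1 2 * Equiv.swap 1 2 =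
      (Equiv.swap 0 1 : Equiv.Perm (Fin 4)) := by decide +kernel
  rw [e5] at h5
  -- Conjugating `(0 1)` by the involution `(0 3)(1 2)` gives `(2 3)`, the last adjacent
  -- transposition.
  have h6 := mul_mem (mul_mem h2 h5) h2
  have e6 : Equiv.swap 0 3 * Equiv.swap 1 2 * Equiv.swap 0 1 * (Equiv.swap 0 3 * Equiv.swap 1 2) =
      (Equiv.swap 2 3 : Equiv.Perm (Fin 4)) := by decide +kernel
  rw [e6] at h6
  refine eq_top_of_adjacent_swap_mem (n := 3) fun i => ?_
  fin_cases i
  exacts [h5, h3, h6]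

theorem laderman_automorphisms (K : Type*) [Field K] :
    (∃ Φ₁ Φ₂ Φ₃ Φ₄ : MMSpace K 3 3 3 ≃ₗ[K] MMSpace K 3 3 3,
      (∀ x y z, Φ₁ (tri x y z) = tri (pi23 K * x * pi13 K) (pi13 K * y) (z * pi23 K)) ∧
      (∀ x y z, Φ₂ (tri x y z) = tri (pi23 K * x) (y * pi23 K) (pi23 K * z * pi23 K)) ∧
      (∀ x y z, Φ₃ (tri x y z) = tri (yᵀ * eps2 K) (eps2 K * xᵀ) zᵀ) ∧
      (∀ x y z, Φ₄ (tri x y z) =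
        tri (eps1 K * z * pi12 K) (pi12 K * x * pi12 K * eps1 K)
          (eps1 K * pi12 K * y * eps1 K)) ∧
      autGroup (Set.range (laderman K)) = Subgroup.closure {Φ₁, Φ₂, Φ₃, Φ₄}) ∧
    Nonempty (autGroup (Set.range (laderman K)) ≃* Equiv.Perm (Fin 4)) := by
  obtain ⟨Φ₁, hΦ₁, h₁, m₁⟩ := exists_straight_automorphism (m := 3) (n := 3) (p := 3) (r := 23)
    (rows := ladermanRows)
    (σ := fun l => [0, 12, 10, 11, 14, 13, 15, 16, 17, 9, 2, 3, 1, 5, 4, 6, 7, 8,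
      18, 21, 22, 19, 20].getD l 0)
    (a₀ := [1, 0, 0, 0, 0, 1, 0, 1, 0]) (a₀' := [1, 0, 0, 0, 0, 1, 0, 1, 0])
    (b₀ := [0, 0, 1, 0, 1, 0, 1, 0, 0]) (b₀' := [0, 0, 1, 0, 1, 0, 1, 0, 0])
    (a₁ := [0, 0, 1, 0, 1, 0, 1, 0, 0]) (a₁' := [0, 0, 1, 0, 1, 0, 1, 0, 0])
    (b₁ := [1, 0, 0, 0, 1, 0, 0, 0, 1]) (b₁' := [1, 0, 0, 0, 1, 0, 0, 0, 1])
    (a₂ := [1, 0, 0, 0, 1, 0, 0, 0, 1]) (a₂' := [1, 0, 0, 0, 1, 0, 0, 0, 1])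
    (b₂ := [1, 0, 0, 0, 0, 1, 0, 1, 0]) (b₂' := [1, 0, 0, 0, 0, 1, 0, 1, 0]) K
    (by decide +kernel) (by decide +kernel) (by decide +kernel) (by decide +kernel)
    (by decide +kernel) (by decide +kernel) (by decide +kernel)
  obtain ⟨Φ₂, hΦ₂, h₂, m₂⟩ := exists_straight_automorphism (m := 3) (n := 3) (p := 3) (r := 23)
    (rows := ladermanRows)
    (σ := fun l => [9, 7, 10, 6, 8, 5, 3, 1, 4, 0, 2, 15, 16, 13, 17, 11, 12, 14,
      18, 22, 21, 20, 19].getD l 0)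
    (a₀ := [1, 0, 0, 0, 0, 1, 0, 1, 0]) (a₀' := [1, 0, 0, 0, 0, 1, 0, 1, 0])
    (b₀ := [1, 0, 0, 0, 1, 0, 0, 0, 1]) (b₀' := [1, 0, 0, 0, 1, 0, 0, 0, 1])
    (a₁ := [1, 0, 0, 0, 1, 0, 0, 0, 1]) (a₁' := [1, 0, 0, 0, 1, 0, 0, 0, 1])
    (b₁ := [1, 0, 0, 0, 0, 1, 0, 1, 0]) (b₁' := [1, 0, 0, 0, 0, 1, 0, 1, 0])
    (a₂ := [1, 0, 0, 0, 0, 1, 0, 1, 0]) (a₂' := [1, 0, 0, 0, 0, 1, 0, 1, 0])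
    (b₂ := [1, 0, 0, 0, 0, 1, 0, 1, 0]) (b₂' := [1, 0, 0, 0, 0, 1, 0, 1, 0]) K
    (by decide +kernel) (by decide +kernel) (by decide +kernel) (by decide +kernel)
    (by decide +kernel) (by decide +kernel) (by decide +kernel)
  obtain ⟨Φ₃, hΦ₃, h₃, m₃⟩ := exists_swap_automorphism (m := 3) (n := 3) (r := 23)
    (rows := ladermanRows)
    (σ := fun l => [2, 4, 0, 3, 1, 5, 6, 8, 7, 10, 9, 15, 17, 13, 16, 11, 14, 12,
      18, 19, 21, 20, 22].getD l 0)
    (a₀ := [1, 0, 0, 0, 1, 0, 0, 0, 1]) (a₀' := [1, 0, 0, 0, 1, 0, 0, 0, 1])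
    (b₀ := [1, 0, 0, 0, -1, 0, 0, 0, 1]) (b₀' := [1, 0, 0, 0, -1, 0, 0, 0, 1])
    (a₁ := [1, 0, 0, 0, -1, 0, 0, 0, 1]) (a₁' := [1, 0, 0, 0, -1, 0, 0, 0, 1])
    (b₁ := [1, 0, 0, 0, 1, 0, 0, 0, 1]) (b₁' := [1, 0, 0, 0, 1, 0, 0, 0, 1])
    (a₂ := [1, 0, 0, 0, 1, 0, 0, 0, 1]) (a₂' := [1, 0, 0, 0, 1, 0, 0, 0, 1])
    (b₂ := [1, 0, 0, 0, 1, 0, 0, 0, 1]) (b₂' := [1, 0, 0, 0, 1, 0, 0, 0, 1]) K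
    (by decide +kernel) (by decide +kernel) (by decide +kernel) (by decide +kernel)
    (by decide +kernel) (by decide +kernel) (by decide +kernel)
  -- `b₁` is the product `π₁₂ε₁` and `a₂` is `ε₁π₁₂`; they are not symmetric, so their inverses
  -- differ from them.
  obtain ⟨Φ₄, hΦ₄, h₄, m₄⟩ := exists_cycle_automorphism (n := 3) (r := 23)
    (rows := ladermanRows)
    (σ := fun l => [2, 1, 5, 3, 4, 0, 11, 12, 14, 10, 13, 15, 16, 9, 17, 6, 7, 8,
      18, 20, 21, 19, 22].getD l 0)
    (a₀ := [-1, 0, 0, 0, 1, 0, 0, 0, 1]) (a₀' := [-1, 0, 0, 0, 1, 0, 0, 0, 1])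
    (b₀ := [0, 1, 0, 1, 0, 0, 0, 0, 1]) (b₀' := [0, 1, 0, 1, 0, 0, 0, 0, 1])
    (a₁ := [0, 1, 0, 1, 0, 0, 0, 0, 1]) (a₁' := [0, 1, 0, 1, 0, 0, 0, 0, 1])
    (b₁ := [0, 1, 0, -1, 0, 0, 0, 0, 1]) (b₁' := [0, -1, 0, 1, 0, 0, 0, 0, 1])
    (a₂ := [0, -1, 0, 1, 0, 0, 0, 0, 1]) (a₂' := [0, 1, 0, -1, 0, 0, 0, 0, 1])
    (b₂ := [-1, 0, 0, 0, 1, 0, 0, 0, 1]) (b₂' := [-1, 0, 0, 0, 1, 0, 0, 0, 1]) K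
    (by decide +kernel) (by decide +kernel) (by decide +kernel) (by decide +kernel)
    (by decide +kernel) (by decide +kernel) (by decide +kernel)
  obtain ⟨hclosure, hiso⟩ := closure_eq_and_nonempty_mulEquiv
    (A := autGroup (Set.range (laderman K))) (act := MonoidHom.id (Equiv.Perm (Fin 4)))
    (S := {Φ₁, Φ₂, Φ₃, Φ₄})
    (t := fun w => rowTensor K ![3, 3, 3] ladermanRows (ladermanVertex w))
    (fun v w h => ladermanVertex_injective
      (laderman_scheme.rowTensor_injOn (ladermanVertex_lt v) (ladermanVertex_lt w) h))
    Function.injective_id (fun φ hφ => laderman_action hφ)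
    (fun φ hφ hfix => laderman_eq_one hφ hfix)
    (by
      rw [laderman_eq_rowTensor]
      rintro φ (rfl | rfl | rfl | rfl)
      · exact mem_autGroup_of_map_rowTensor hΦ₁ (by decide +kernel) m₁
      · exact mem_autGroup_of_map_rowTensor hΦ₂ (by decide +kernel) m₂
      · exact mem_autGroup_of_map_rowTensor hΦ₃ (by decide +kernel) m₃
      · exact mem_autGroup_of_map_rowTensor hΦ₄ (by decide +kernel) m₄)
    closure_ladermanGenerators
    (by
      rintro q (rfl | rfl | rfl | rfl)
      · refine ⟨Φ₁, by simp, fun w => (m₁ _ (ladermanVertex_lt w)).trans (congrArg _ ?_)⟩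
        revert w
        decide +kernel
      · refine ⟨Φ₂, by simp, fun w => (m₂ _ (ladermanVertex_lt w)).trans (congrArg _ ?_)⟩
        revert w
        decide +kernel
      · refine ⟨Φ₃, by simp, fun w => (m₃ _ (ladermanVertex_lt w)).trans (congrArg _ ?_)⟩
        revert w
        decide +kernel
      · refine ⟨Φ₄, by simp, fun w => (m₄ _ (ladermanVertex_lt w)).trans (congrArg _ ?_)⟩
        revert w
        decide +kernel)
  have e : flatMat K 3 3 [0, 1, 0, 1, 0, 0, 0, 0, 1] * flatMat K 3 3 [-1, 0, 0, 0, 1, 0, 0, 0, 1] =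
      flatMat K 3 3 [0, 1, 0, -1, 0, 0, 0, 0, 1] := flatMat_mul (by decide +kernel)
  have e' : flatMat K 3 3 [-1, 0, 0, 0, 1, 0, 0, 0, 1] * flatMat K 3 3 [0, 1, 0, 1, 0, 0, 0, 0, 1] =
      flatMat K 3 3 [0, -1, 0, 1, 0, 0, 0, 0, 1] := flatMat_mul (by decide +kernel)
  refine ⟨⟨Φ₁, Φ₂, Φ₃, Φ₄, fun x y z => ?_, fun x y z => ?_, fun x y z => ?_, fun x y z => ?_,
    hclosure⟩, hiso⟩
  · rw [h₁, pi13_eq_flatMat, pi23_eq_flatMat, flatMat_identity_three, Matrix.one_mul,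
      Matrix.mul_one]
  · rw [h₂, pi23_eq_flatMat, flatMat_identity_three, Matrix.one_mul, Matrix.mul_one]
  · rw [h₃, eps2_eq_flatMat, flatMat_identity_three]
    simp only [Matrix.one_mul, Matrix.mul_one]
  · rw [h₄, pi12_eq_flatMat, eps1_eq_flatMat, e', Matrix.mul_assoc (_ * x), e]

/-! ### The theorem -/

theorem theorem1 (K : Type*) [Field K] :
    (IsAlgorithm (hopcroft K) (matMulTensor K 3 2 3) ∧
      (∃ Φ₁ Φ₂ Φ₃ : MMSpace K 3 2 3 ≃ₗ[K] MMSpace K 3 2 3,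
        (∀ x y z, Φ₁ (tri x y z) =
          tri (pi123 K * x * (sqD K)⁻¹) (sqD K * y * (pi123 K)⁻¹)
            (pi123 K * z * (pi123 K)⁻¹)) ∧
        (∀ x y z, Φ₂ (tri x y z) =
          tri (pi13 K * x * sq12 K) (sq12 K * y * pi13 K) (pi13 K * z * pi13 K)) ∧
        (∀ x y z, Φ₃ (tri x y z) =
          tri (yᵀ * sq12 K * sqEps1 K) (sqEps1 K * sq12 K * xᵀ) zᵀ) ∧
        autGroup (Set.range (hopcroft K)) = Subgroup.closure {Φ₁, Φ₂, Φ₃}) ∧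
      Nonempty (autGroup (Set.range (hopcroft K)) ≃*
        Equiv.Perm (Fin 3) × Multiplicative (ZMod 2))) ∧
    (IsAlgorithm (laderman K) (matMulTensor K 3 3 3) ∧
      (∃ Φ₁ Φ₂ Φ₃ Φ₄ : MMSpace K 3 3 3 ≃ₗ[K] MMSpace K 3 3 3,
        (∀ x y z, Φ₁ (tri x y z) = tri (pi23 K * x * pi13 K) (pi13 K * y) (z * pi23 K)) ∧
        (∀ x y z, Φ₂ (tri x y z) = tri (pi23 K * x) (y * pi23 K) (pi23 K * z * pi23 K)) ∧
        (∀ x y z, Φ₃ (tri x y z) = tri (yᵀ * eps2 K) (eps2 K * xᵀ) zᵀ) ∧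
        (∀ x y z, Φ₄ (tri x y z) =
          tri (eps1 K * z * pi12 K) (pi12 K * x * pi12 K * eps1 K)
            (eps1 K * pi12 K * y * eps1 K)) ∧
        autGroup (Set.range (laderman K)) = Subgroup.closure {Φ₁, Φ₂, Φ₃, Φ₄}) ∧
      Nonempty (autGroup (Set.range (laderman K)) ≃* Equiv.Perm (Fin 4))) :=
  ⟨⟨isAlgorithm_hopcroft K, hopcroft_automorphisms K⟩,
    ⟨isAlgorithm_laderman K, laderman_automorphisms K⟩⟩
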